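/- Consider a discrete memoryless interference channel $p(y_1,y_2|x_1,x_2)$ with finite input alphabets $\mathcal X_1,\mathcal X_2$ and finite output alphabets $\mathcal Y_1,\mathcal Y_2$; its $n$-fold use has transition probabilities $\prod_{i=1}^n p(y_{1,i},y_{2,i}|x_{1,i},x_{2,i})$. For $k=1,2$, Transmitter $k$ has two messages $W_{ks}$ and $W_{kp}$ for Receiver $k$; Receiver 2 also knows $W_{1s}$ and Receiver 1 also knows $W_{2s}$. All four messages are independent and uniform. For rates $R_{1s},R_{1p},R_{2s},R_{2p}\ge 0$ put $M_{kj}=\lceil 2^{nR_{kj}}\rceil$ and $[M]=\{1,\dots,M\}$. A code of block length $n$ with these rates consists of encoders $f_k:[M_{ks}]\times[M_{kp}]\to\mathcal X_k^n$ ($k=1,2$) and decoders $g_1:\mathcal Y_1^n\times[M_{2s}]\to[M_{1s}]\times[M_{1p}]$ and $g_2:\mathcal Y_2^n\times[M_{1s}]\to[M_{2s}]\times[M_{2p}]$. Its error probability is $$P_e^n=\Pr\{g_1(Y_1^n,W_{2s})\ne(W_{1s},W_{1p})\ \text{ or }\ g_2(Y_2^n,W_{1s})\ne(W_{2s},W_{2p})\}.$$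 A quadruple $(R_{1s},R_{1p},R_{2s},R_{2p})$ is achievable if there is a sequence of such codes, one for each $n$, with $P_e^n\to0$. The capacity region $\mathcal C_I\subseteq\mathbb R^4$ is the closure of the set of achievable quadruples. For $n\ge1$ let $\mathcal G^n$ be the set of all $(R_{1s},R_{1p},R_{2s},R_{2p})$ with nonnegative entries such that $$R_{1p}\le\tfrac1n I(X_1^n;Y_1^n|S_{1s}^n,S_{2s}^n),\qquad R_{1s}+R_{1p}\le\tfrac1n I(X_1^n;Y_1^n|S_{2s}^n),$$ $$R_{2p}\le\tfrac1n I(X_2^n;Y_2^n|S_{1s}^n,S_{2s}^n),\qquad R_{2s}+R_{2p}\le\tfrac1n I(X_2^n;Y_2^n|S_{1s}^n)$$ (logarithms to base 2) for some finite alphabets $\mathcal S_1,\mathcal S_2$ and some distributions $p(s_{1s}^n)$, $p(s_{2s}^n)$, $p(x_1^n|s_{1s}^n)$, $p(x_2^n|s_{2s}^n)$ with $s_{ks}^n\in\mathcal S_k^n$, where the joint distribution is $p(s_{1s}^n)p(s_{2s}^n)p(x_1^n|s_{1s}^n)p(x_2^n|s_{2s}^n)\prod_{i=1}^n p(y_{1,i},y_{2,i}|x_{1,i},x_{2,i})$.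 Then $$\mathcal C_I=\lim_{n\to\infty}\mathcal G^n .$$ That is, $\mathcal C_I$ is both the set of points each of whose neighbourhoods meets $\mathcal G^n$ for all sufficiently large $n$ and the set of points each of whose neighbourhoods meets $\mathcal G^n$ for infinitely many $n$; moreover $\mathcal G^n\subseteq\mathcal C_I$ for every $n\ge1$. The limit is still $\mathcal C_I$ if in $\mathcal G^n$ only the auxiliary alphabets $\mathcal S_1=\mathcal X_1$ and $\mathcal S_2=\mathcal X_2$ are allowed. -/

import Mathlib

open Filter Topology

noncomputable section

namespace InterferenceMSI

/-- Probability of the event `A` under the mass function `p` on a finite set. -/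
def pr {Ω : Type*} [Fintype Ω] (p : Ω → ℝ) (A : Set Ω) : ℝ :=
  ∑ ω, A.indicator p ω

/-- Conditional mutual information `I(X; Y | Z)` in bits of finite-valued random variables on a
finite probability space with mass function `p`. Terms with `P(X = x, Y = y, Z = z) = 0` are `0`;
in every other term the denominator is positive. -/
def condMutualInfo {Ω α β γ : Type*} [Fintype Ω] [Fintype α] [Fintype β] [Fintype γ]
    (p : Ω → ℝ) (X : Ω → α) (Y : Ω → β) (Z : Ω → γ) : ℝ :=
  ∑ x, ∑ y, ∑ z,
    pr p {ω | X ω = x ∧ Y ω = y ∧ Z ω = z} *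
      Real.logb 2
        ((pr p {ω | X ω = x ∧ Y ω = y ∧ Z ω = z} * pr p {ω | Z ω = z}) /
          (pr p {ω | X ω = x ∧ Z ω = z} * pr p {ω | Y ω = y ∧ Z ω = z}))

/-- A two-user discrete interference channel `p(y₁, y₂ | x₁, x₂)`. -/
structure Channel (X₁ X₂ Y₁ Y₂ : Type*) [Fintype Y₁] [Fintype Y₂] where
  /-- `prob x₁ x₂ (y₁, y₂) = p(y₁, y₂ | x₁, x₂)` -/
  prob : X₁ → X₂ → Y₁ × Y₂ → ℝ
  prob_mem : ∀ x₁ x₂, prob x₁ x₂ ∈ stdSimplex ℝ (Y₁ × Y₂)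

/-- Transition probabilities of `n` memoryless uses of the channel. -/
def Channel.block {X₁ X₂ Y₁ Y₂ : Type*} [Fintype Y₁] [Fintype Y₂] (W : Channel X₁ X₂ Y₁ Y₂)
    (n : ℕ) (x₁ : Fin n → X₁) (x₂ : Fin n → X₂) (y₁ : Fin n → Y₁) (y₂ : Fin n → Y₂) : ℝ :=
  ∏ i, W.prob (x₁ i) (x₂ i) (y₁ i, y₂ i)

/-- A code of block length `n` with message sets of sizes `M₁s, M₁p, M₂s, M₂p`. Receiver 1 knows
the message `w₂s`, Receiver 2 knows the message `w₁s`. -/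
structure Code (X₁ X₂ Y₁ Y₂ : Type*) (M₁s M₁p M₂s M₂p n : ℕ) where
  enc₁ : Fin M₁s × Fin M₁p → (Fin n → X₁)
  enc₂ : Fin M₂s × Fin M₂p → (Fin n → X₂)
  dec₁ : (Fin n → Y₁) × Fin M₂s → Fin M₁s × Fin M₁p
  dec₂ : (Fin n → Y₂) × Fin M₁s → Fin M₂s × Fin M₂p

/-- Average probability, over independent uniform messages, that at least one receiver errs. -/
def Code.errorProb {X₁ X₂ Y₁ Y₂ : Type*} [Fintype Y₁] [Fintype Y₂] {M₁s M₁p M₂s M₂p n : ℕ}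
    (c : Code X₁ X₂ Y₁ Y₂ M₁s M₁p M₂s M₂p n) (W : Channel X₁ X₂ Y₁ Y₂) : ℝ :=
  (1 / ((M₁s : ℝ) * M₁p * M₂s * M₂p)) *
    ∑ w₁s : Fin M₁s, ∑ w₁p : Fin M₁p, ∑ w₂s : Fin M₂s, ∑ w₂p : Fin M₂p,
      ∑ y₁ : Fin n → Y₁, ∑ y₂ : Fin n → Y₂,
        if c.dec₁ (y₁, w₂s) ≠ (w₁s, w₁p) ∨ c.dec₂ (y₂, w₁s) ≠ (w₂s, w₂p) then
          W.block n (c.enc₁ (w₁s, w₁p)) (c.enc₂ (w₂s, w₂p)) y₁ y₂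
        else 0

/-- Number `⌈2 ^ (n R)⌉` of messages at rate `R` bits per channel use and block length `n`. -/
def numMsg (n : ℕ) (R : ℝ) : ℕ := ⌈(2 : ℝ) ^ ((n : ℝ) * R)⌉₊

/-- Rate quadruples `(R₁s, R₁p, R₂s, R₂p)`. -/
abbrev Rates : Type := ℝ × ℝ × ℝ × ℝ

/-- A quadruple of nonnegative rates is achievable if some sequence of codes of these rates, one
for each block length, has error probability tending to `0`. -/
def Achievable {X₁ X₂ Y₁ Y₂ : Type*} [Fintype Y₁] [Fintype Y₂] (W : Channel X₁ X₂ Y₁ Y₂) :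
    Rates → Prop
  | (R₁s, R₁p, R₂s, R₂p) =>
    (0 ≤ R₁s ∧ 0 ≤ R₁p ∧ 0 ≤ R₂s ∧ 0 ≤ R₂p) ∧
    ∃ c : ∀ n : ℕ, Code X₁ X₂ Y₁ Y₂ (numMsg n R₁s) (numMsg n R₁p) (numMsg n R₂s) (numMsg n R₂p) n,
      Tendsto (fun n => (c n).errorProb W) atTop (𝓝 0)

/-- The capacity region: the closure of the set of achievable rate quadruples. -/
def capacityRegion {X₁ X₂ Y₁ Y₂ : Type*} [Fintype Y₁] [Fintype Y₂]
    (W : Channel X₁ X₂ Y₁ Y₂) : Set Rates :=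
  closure {R | Achievable W R}

/-- The joint mass function `p(s₁) p(s₂) p(x₁|s₁) p(x₂|s₂) p(y₁, y₂|x₁, x₂)`. -/
def joint {S₁ S₂ A₁ A₂ B₁ B₂ : Type*} (p₁ : S₁ → ℝ) (p₂ : S₂ → ℝ) (q₁ : S₁ → A₁ → ℝ)
    (q₂ : S₂ → A₂ → ℝ) (V : A₁ → A₂ → B₁ → B₂ → ℝ) : S₁ × S₂ × A₁ × A₂ × B₁ × B₂ → ℝ
  | (s₁, s₂, a₁, a₂, b₁, b₂) => p₁ s₁ * p₂ s₂ * q₁ s₁ a₁ * q₂ s₂ a₂ * V a₁ a₂ b₁ b₂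

/-- The `n`-letter region for auxiliary sequences with letters in the finite alphabets
`S₁` and `S₂`. -/
def nLetterRegionWith {X₁ X₂ Y₁ Y₂ : Type*} [Fintype X₁] [Fintype X₂] [Fintype Y₁] [Fintype Y₂]
    (W : Channel X₁ X₂ Y₁ Y₂) (S₁ S₂ : Type*) [Fintype S₁] [Fintype S₂] (n : ℕ) : Set Rates :=
  {(R₁s, R₁p, R₂s, R₂p) : Rates |
    (0 ≤ R₁s ∧ 0 ≤ R₁p ∧ 0 ≤ R₂s ∧ 0 ≤ R₂p) ∧
    ∃ (p₁ : (Fin n → S₁) → ℝ) (p₂ : (Fin n → S₂) → ℝ)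
      (q₁ : (Fin n → S₁) → (Fin n → X₁) → ℝ) (q₂ : (Fin n → S₂) → (Fin n → X₂) → ℝ),
      p₁ ∈ stdSimplex ℝ (Fin n → S₁) ∧ p₂ ∈ stdSimplex ℝ (Fin n → S₂) ∧
      (∀ s, q₁ s ∈ stdSimplex ℝ (Fin n → X₁)) ∧ (∀ s, q₂ s ∈ stdSimplex ℝ (Fin n → X₂)) ∧
      let P := joint p₁ p₂ q₁ q₂ (W.block n)
      R₁p ≤ 1 / (n : ℝ) * condMutualInfo P
        (fun (_, _, x₁, _, _, _) => x₁) (fun (_, _, _, _, y₁, _) => y₁)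
        (fun (s₁, s₂, _, _, _, _) => (s₁, s₂)) ∧
      R₁s + R₁p ≤ 1 / (n : ℝ) * condMutualInfo P
        (fun (_, _, x₁, _, _, _) => x₁) (fun (_, _, _, _, y₁, _) => y₁)
        (fun (_, s₂, _, _, _, _) => s₂) ∧
      R₂p ≤ 1 / (n : ℝ) * condMutualInfo P
        (fun (_, _, _, x₂, _, _) => x₂) (fun (_, _, _, _, _, y₂) => y₂)
        (fun (s₁, s₂, _, _, _, _) => (s₁, s₂)) ∧
      R₂s + R₂p ≤ 1 / (n : ℝ) * condMutualInfo P
        (fun (_, _, _, x₂, _, _) => x₂) (fun (_, _, _, _, _, y₂) => y₂)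
        (fun (s₁, _, _, _, _, _) => s₁)}

/-- The `n`-letter region `𝒢ⁿ`, with arbitrary finite auxiliary alphabets. -/
def nLetterRegion {X₁ X₂ Y₁ Y₂ : Type*} [Fintype X₁] [Fintype X₂] [Fintype Y₁] [Fintype Y₂]
    (W : Channel X₁ X₂ Y₁ Y₂) (n : ℕ) : Set Rates :=
  ⋃ (m₁ : ℕ) (m₂ : ℕ), nLetterRegionWith W (Fin m₁) (Fin m₂) n

/-- Lower limit of a sequence of sets: every neighbourhood of the point meets `A n` for all large
`n`. -/
def lowerLimit {E : Type*} [TopologicalSpace E] (A : ℕ → Set E) : Set E :=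
  {x | ∀ U ∈ 𝓝 x, ∀ᶠ n in atTop, (A n ∩ U).Nonempty}

/-- Upper limit of a sequence of sets: every neighbourhood of the point meets `A n` for infinitely
many `n`. -/
def upperLimit {E : Type*} [TopologicalSpace E] (A : ℕ → Set E) : Set E :=
  {x | ∀ U ∈ 𝓝 x, ∃ᶠ n in atTop, (A n ∩ U).Nonempty}

/-- `L` is the (Painlevé–Kuratowski) limit of the sequence of sets `A n`. -/
def IsSetLimit {E : Type*} [TopologicalSpace E] (A : ℕ → Set E) (L : Set E) : Prop :=
  lowerLimit A = L ∧ upperLimit A = L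

end InterferenceMSI

end

namespace InterferenceMSI

noncomputable section

/-! ### Expectations under product weights -/

section ProductWeights

variable {ι α : Type*} [Fintype ι] [DecidableEq ι] [Fintype α]

/-! The auxiliary sequence of each user stands for the message that the other receiver knows.

Converse. Given a code of length `n`, let the auxiliary sequence be an injective image of the common
message and the channel input be the codeword. Receiver 1 sees a channel with input `x₁` and state
`s₂`, the input of user 2 being averaged given `s₂`. Fano's inequality, in the form `fano`,
conditioned on `s₂` alone bounds the sum rate; conditioned on both auxiliary sequences it bounds the
private rate. The loss is one bit per block and a factor `1 - Pₑ`, so slightly reduced rates lie in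
the `n`-letter region (`reduced_rates_mem`), and the reduction vanishes as `n → ∞`. Reliable
decoding also forces the number of common messages to be at most `|X_k|ⁿ`, because the output law
depends on the message only through the codeword. Hence the images fit in `X_kⁿ`, and the alphabets
`X_k` are already enough.

Achievability. Treat `n` letters as one super-letter and use independent super-letters. User `k`
draws one cloud centre per common message and, conditionally on it, one codeword per private
message. Receiver 1 knows the cloud centre of user 2, so it faces a channel with known state. It
looks for the unique codeword whose likelihood ratios, against the average over its own cloud and
against the average over all inputs, exceed thresholds slightly below the two mutual informations.
The transmitted codeword passes by Chebyshev's inequality. A false codeword in the right cloud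
passes with probability at most `1/τ₁`, and one in another cloud with probability at most `1/τ₂`.
These two events give exactly the two rate constraints of a receiver (`exists_code_rxErr_le`,
`achievable_scaled`). Scaling the rates by `θ < 1` provides the slack, and taking the closure
removes it.

Thus achievable points lie in the lower limit and every region with `n ≥ 1` lies in the closure of
the achievable points, which fixes both set limits (`isSetLimit_closure`). -/

lemma sum_prod_pi (g : ι → α → ℝ) : ∑ f : ι → α, ∏ k, g k (f k) = ∏ k, ∑ a, g k a := by
  rw [Finset.prod_univ_sum, Fintype.piFinset_univ]

lemma sum_pi_weight {μ : α → ℝ} (hμ : ∑ a, μ a = 1) : ∑ f : ι → α, ∏ k, μ (f k) = 1 := by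
  rw [sum_prod_pi (fun _ => μ)]; simp [hμ]

lemma sum_pi_eval {μ : α → ℝ} (hμ : ∑ a, μ a = 1) (h : α → ℝ) (i : ι) :
    ∑ f : ι → α, (∏ k, μ (f k)) * h (f i) = ∑ a, μ a * h a := by
  have h1 : ∀ f : ι → α, (∏ k, μ (f k)) * h (f i)
      = ∏ k, (μ (f k) * if k = i then h (f k) else 1) := by
    intro f; rw [Finset.prod_mul_distrib, Finset.prod_ite_eq' Finset.univ i]; simp
  simp_rw [h1]
  rw [sum_prod_pi (fun k a => μ a * if k = i then h a else 1)]
  rw [Finset.prod_eq_single i]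
  · simp
  · intro k _ hk; simp [hk, hμ]
  · simp

lemma sum_pi_eval_mul {μ : α → ℝ} (hμ : ∑ a, μ a = 1) (u v : α → ℝ) {i j : ι} (hij : i ≠ j) :
    ∑ f : ι → α, (∏ k, μ (f k)) * (u (f i) * v (f j)) = (∑ a, μ a * u a) * ∑ a, μ a * v a := by
  have h1 : ∀ f : ι → α, (∏ k, μ (f k)) * (u (f i) * v (f j))
      = ∏ k, (μ (f k) * ((if k = i then u (f k) else 1) * if k = j then v (f k) else 1)) := by
    intro f
    rw [Finset.prod_mul_distrib, Finset.prod_mul_distrib, Finset.prod_ite_eq' Finset.univ i,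
      Finset.prod_ite_eq' Finset.univ j]; simp
  simp_rw [h1]
  rw [sum_prod_pi (fun k a => μ a * ((if k = i then u a else 1) * if k = j then v a else 1))]
  rw [Finset.prod_eq_mul i j hij]
  · simp [hij, hij.symm]
  · intro k _ hk; simp [hk.1, hk.2, hμ]
  · simp
  · simp

lemma sum_pi_eval_two [DecidableEq α] {μ : α → ℝ} (hμ : ∑ a, μ a = 1) (h : α → α → ℝ) {i j : ι}
    (hij : i ≠ j) :
    ∑ f : ι → α, (∏ k, μ (f k)) * h (f i) (f j) = ∑ a, ∑ b, μ a * μ b * h a b := by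
  have h1 : ∀ f : ι → α, (∏ k, μ (f k)) * h (f i) (f j)
      = ∑ a, (∏ k, μ (f k)) * ((if f i = a then 1 else 0) * h a (f j)) := by
    intro f; simp [Finset.sum_ite_eq]
  simp_rw [h1]
  rw [Finset.sum_comm]
  refine Finset.sum_congr rfl fun a _ => ?_
  rw [sum_pi_eval_mul hμ (fun x => if x = a then 1 else 0) (h a) hij]
  simp [Finset.mul_sum, mul_assoc]

end ProductWeights

/-- The averaging step of the random coding argument: some outcome does no worse than the mean. -/
lemma exists_le_of_weighted_sum_le {α : Type*} [Fintype α] {μ F : α → ℝ} {β : ℝ}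
    (h0 : ∀ a, 0 ≤ μ a) (h1 : ∑ a, μ a = 1) (h : ∑ a, μ a * F a ≤ β) : ∃ a, F a ≤ β := by
  by_contra! hc
  have h2 : ∑ a, μ a * (F a - β) ≤ 0 := by
    simp_rw [mul_sub]; rw [Finset.sum_sub_distrib, ← Finset.sum_mul, h1]; linarith
  have h3 : ∀ a ∈ Finset.univ, 0 ≤ μ a * (F a - β) := fun a _ =>
    mul_nonneg (h0 a) (by linarith [hc a])
  have h4 := (Finset.sum_eq_zero_iff_of_nonneg h3).1 (le_antisymm h2 (Finset.sum_nonneg h3))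
  have h5 : ∑ a, μ a = 0 := Finset.sum_eq_zero fun a ha => by
    rcases mul_eq_zero.1 (h4 a ha) with h | h
    · exact h
    · linarith [hc a]
  linarith

/-! ### Mutual information of a channel with side information -/

/-- Mutual information, in bits, between input and output of the channel `V z` with input law
`r z`, averaged over the state `z` of law `ν`. -/
def chanInfo {Z A B : Type*} [Fintype Z] [Fintype A] [Fintype B] (ν : Z → ℝ) (r : Z → A → ℝ)
    (V : Z → A → B → ℝ) : ℝ :=
  ∑ z, ∑ a, ∑ b, ν z * r z a * V z a b * Real.logb 2 (V z a b / ∑ a', r z a' * V z a' b)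

lemma pr_eq_sum_fiber {Ω α : Type*} [Fintype Ω] [Fintype α] (p : Ω → ℝ) (X : Ω → α)
    (A : Ω → Prop) : pr p {ω | A ω} = ∑ x, pr p {ω | X ω = x ∧ A ω} := by
  classical
  unfold pr
  rw [Finset.sum_comm]
  refine Finset.sum_congr rfl fun ω _ => ?_
  simp only [Set.indicator_apply, Set.mem_ofPred_eq, ite_and]
  simp

/-- Summing out a coordinate turns the factorization of the joint law into formulas for all its
marginals. The factor `ν z * r z x * ν z` then cancels inside the logarithm, and where it vanishes
the term has weight zero. -/
lemma condMutualInfo_eq_chanInfo {Ω α β γ : Type*} [Fintype Ω] [Fintype α] [Fintype β]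
    [Fintype γ] {p : Ω → ℝ} {X : Ω → α} {Y : Ω → β} {Z : Ω → γ} {ν : γ → ℝ} {r : γ → α → ℝ}
    {V : γ → α → β → ℝ} (hr : ∀ z, ∑ x, r z x = 1) (hV : ∀ z x, ∑ y, V z x y = 1)
    (h : ∀ x y z, pr p {ω | X ω = x ∧ Y ω = y ∧ Z ω = z} = ν z * r z x * V z x y) :
    condMutualInfo p X Y Z = chanInfo ν r V := by
  have hXZ : ∀ x z, pr p {ω | X ω = x ∧ Z ω = z} = ν z * r z x := by
    intro x z
    rw [pr_eq_sum_fiber p Y]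
    simp_rw [and_left_comm (a := Y _ = _), h]
    rw [← Finset.mul_sum, hV, mul_one]
  have hYZ : ∀ y z, pr p {ω | Y ω = y ∧ Z ω = z} = ν z * ∑ x, r z x * V z x y := by
    intro x z
    rw [pr_eq_sum_fiber p X]
    simp_rw [h]
    rw [Finset.mul_sum]; simp_rw [mul_assoc]
  have hZ : ∀ z, pr p {ω | Z ω = z} = ν z := by
    intro z
    rw [pr_eq_sum_fiber p X]
    simp_rw [hXZ]
    rw [← Finset.mul_sum, hr, mul_one]
  unfold condMutualInfo chanInfo
  simp_rw [h, hXZ, hYZ, hZ]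
  have h3 : ∀ x y z, ν z * r z x * V z x y *
      Real.logb 2 (ν z * r z x * V z x y * ν z / (ν z * r z x * (ν z * ∑ x, r z x * V z x y))) =
      ν z * r z x * V z x y * Real.logb 2 (V z x y / ∑ a', r z a' * V z a' y) := by
    intro x y z
    by_cases h0 : ν z * r z x = 0
    · simp [h0]
    · have h1 : ν z ≠ 0 := left_ne_zero_of_mul h0
      congr 2
      rw [show ν z * r z x * V z x y * ν z = (ν z * r z x * ν z) * V z x y by ring,
        ← mul_assoc, mul_div_mul_left _ _ (mul_ne_zero h0 h1)]
  simp_rw [h3]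
  simp_rw [Finset.sum_comm (s := (Finset.univ : Finset β))]
  rw [Finset.sum_comm]

/-- The channel from the first input to the first output when the second input has law `q s`. -/
def effChan {S A₁ A₂ B₁ B₂ : Type*} [Fintype A₂] [Fintype B₂] (q : S → A₂ → ℝ)
    (V : A₁ → A₂ → B₁ → B₂ → ℝ) (s : S) (a₁ : A₁) (b₁ : B₁) : ℝ :=
  ∑ a₂, q s a₂ * ∑ b₂, V a₁ a₂ b₁ b₂

/-- The interference channel with the two users exchanged. -/
def swapChan {A₁ A₂ B₁ B₂ : Type*} (V : A₁ → A₂ → B₁ → B₂ → ℝ) : A₂ → A₁ → B₂ → B₁ → ℝ :=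
  fun a₂ a₁ b₂ b₁ => V a₁ a₂ b₁ b₂

/-- Transition probabilities: nonnegative, of total mass one for each pair of inputs. -/
structure IsChan {A₁ A₂ B₁ B₂ : Type*} [Fintype B₁] [Fintype B₂]
    (V : A₁ → A₂ → B₁ → B₂ → ℝ) : Prop where
  nonneg : ∀ a₁ a₂ b₁ b₂, 0 ≤ V a₁ a₂ b₁ b₂
  sum_eq_one : ∀ a₁ a₂, ∑ b₁, ∑ b₂, V a₁ a₂ b₁ b₂ = 1

section Joint

variable {S₁ S₂ A₁ A₂ B₁ B₂ : Type*} [Fintype B₁] [Fintype B₂] {V : A₁ → A₂ → B₁ → B₂ → ℝ}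
  {p₁ : S₁ → ℝ} {p₂ : S₂ → ℝ} {q₁ : S₁ → A₁ → ℝ} {q₂ : S₂ → A₂ → ℝ}

lemma IsChan.swap (hV : IsChan V) : IsChan (swapChan V) where
  nonneg _ _ _ _ := hV.nonneg _ _ _ _
  sum_eq_one a₂ a₁ := by
    unfold swapChan; rw [Finset.sum_comm]; exact hV.sum_eq_one a₁ a₂

lemma effChan_mem [Fintype A₂] (hV : IsChan V) {s : S₂} (hq : q₂ s ∈ stdSimplex ℝ A₂) (a : A₁) :
    effChan q₂ V s a ∈ stdSimplex ℝ B₁ := by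
  refine ⟨fun b => Finset.sum_nonneg fun a₂ _ => mul_nonneg (hq.1 a₂)
    (Finset.sum_nonneg fun _ _ => hV.nonneg _ _ _ _), ?_⟩
  unfold effChan
  rw [Finset.sum_comm]
  simp_rw [← Finset.mul_sum, hV.sum_eq_one, mul_one]
  exact hq.2

lemma prod_weight_mem [Fintype S₁] [Fintype S₂] (hp₁ : p₁ ∈ stdSimplex ℝ S₁)
    (hp₂ : p₂ ∈ stdSimplex ℝ S₂) :
    (fun z : S₁ × S₂ => p₁ z.1 * p₂ z.2) ∈ stdSimplex ℝ (S₁ × S₂) := by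
  refine ⟨fun z => mul_nonneg (hp₁.1 _) (hp₂.1 _), ?_⟩
  rw [Fintype.sum_prod_type]
  simp_rw [← Finset.mul_sum, hp₂.2, mul_one, hp₁.2]

variable [Fintype S₁] [Fintype A₁]

lemma mix_mem (hp : p₁ ∈ stdSimplex ℝ S₁) (hq : ∀ s, q₁ s ∈ stdSimplex ℝ A₁) :
    (fun a => ∑ s, p₁ s * q₁ s a) ∈ stdSimplex ℝ A₁ := by
  refine ⟨fun a => Finset.sum_nonneg fun s _ => mul_nonneg (hp.1 s) ((hq s).1 a), ?_⟩
  rw [Finset.sum_comm]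
  simp_rw [← Finset.mul_sum, (hq _).2, mul_one]
  exact hp.2

variable [Fintype S₂] [Fintype A₂]

/-- Given both auxiliary symbols the two inputs are independent. The input law therefore depends on
`s₁` only, and the channel averaged over `x₂` depends on `s₂` only. -/
lemma condMutualInfo_joint_fst_pair (hV : IsChan V) (hq₁ : ∀ s, q₁ s ∈ stdSimplex ℝ A₁)
    (hq₂ : ∀ s, q₂ s ∈ stdSimplex ℝ A₂) :
    condMutualInfo (joint p₁ p₂ q₁ q₂ V) (fun (_, _, x₁, _, _, _) => x₁)
        (fun (_, _, _, _, y₁, _) => y₁) (fun (s₁, s₂, _, _, _, _) => (s₁, s₂)) =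
      chanInfo (fun z : S₁ × S₂ => p₁ z.1 * p₂ z.2) (fun z => q₁ z.1)
        (fun z => effChan q₂ V z.2) := by
  classical
  refine condMutualInfo_eq_chanInfo (fun z => (hq₁ _).2) (fun z x => (effChan_mem hV (hq₂ _) x).2) ?_
  rintro x y ⟨s₁, s₂⟩
  simp only [pr, Set.indicator_apply, Set.mem_ofPred_eq, Prod.mk.injEq, ite_and, joint,
    Fintype.sum_prod_type, effChan, Finset.mul_sum]
  simp [← Finset.mul_sum, mul_assoc]

/-- With `s₁` not observed the input law is the mixture over `s₁`. It does not depend on the state,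
since the two auxiliary symbols are independent. -/
lemma condMutualInfo_joint_fst (hV : IsChan V) (hp₁ : p₁ ∈ stdSimplex ℝ S₁)
    (hq₁ : ∀ s, q₁ s ∈ stdSimplex ℝ A₁) (hq₂ : ∀ s, q₂ s ∈ stdSimplex ℝ A₂) :
    condMutualInfo (joint p₁ p₂ q₁ q₂ V) (fun (_, _, x₁, _, _, _) => x₁)
        (fun (_, _, _, _, y₁, _) => y₁) (fun (_, s₂, _, _, _, _) => s₂) =
      chanInfo p₂ (fun _ a => ∑ s, p₁ s * q₁ s a) (effChan q₂ V) := by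
  classical
  refine condMutualInfo_eq_chanInfo (fun z => (mix_mem hp₁ hq₁).2)
    (fun z x => (effChan_mem hV (hq₂ _) x).2) ?_
  intro x y s₂
  simp only [pr, Set.indicator_apply, Set.mem_ofPred_eq, ite_and, joint,
    Fintype.sum_prod_type, effChan, Finset.mul_sum, Finset.sum_mul]
  simp only [Finset.sum_ite_irrel, Finset.sum_ite_eq', Finset.sum_const_zero, Finset.mem_univ,
    if_true]
  rw [Finset.sum_comm]
  refine Finset.sum_congr rfl fun x₂ _ => ?_
  rw [Finset.sum_comm]
  exact Finset.sum_congr rfl fun y₂ _ => Finset.sum_congr rfl fun s₁ _ => by ring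

lemma chanInfo_prod_comm {Z Z' A B : Type*} [Fintype Z] [Fintype Z'] [Fintype A] [Fintype B]
    (ν : Z × Z' → ℝ) (r : Z × Z' → A → ℝ) (V : Z × Z' → A → B → ℝ) :
    chanInfo ν r V = chanInfo (fun z : Z' × Z => ν z.swap) (fun z => r z.swap)
      (fun z => V z.swap) := by
  unfold chanInfo
  exact (Equiv.sum_comp (Equiv.prodComm Z' Z) _).symm

lemma condMutualInfo_joint_snd_pair (hV : IsChan V) (hq₁ : ∀ s, q₁ s ∈ stdSimplex ℝ A₁)
    (hq₂ : ∀ s, q₂ s ∈ stdSimplex ℝ A₂) :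
    condMutualInfo (joint p₁ p₂ q₁ q₂ V) (fun (_, _, _, x₂, _, _) => x₂)
        (fun (_, _, _, _, _, y₂) => y₂) (fun (s₁, s₂, _, _, _, _) => (s₁, s₂)) =
      chanInfo (fun z : S₂ × S₁ => p₂ z.1 * p₁ z.2) (fun z => q₂ z.1)
        (fun z => effChan q₁ (swapChan V) z.2) := by
  classical
  rw [chanInfo_prod_comm]
  refine condMutualInfo_eq_chanInfo (fun z => (hq₂ _).2)
    (fun z x => (effChan_mem hV.swap (hq₁ _) x).2) ?_
  rintro x y ⟨s₁, s₂⟩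
  simp only [pr, Set.indicator_apply, Set.mem_ofPred_eq, Prod.mk.injEq, ite_and, joint,
    Fintype.sum_prod_type, effChan, swapChan, Finset.mul_sum, Prod.swap]
  simp only [Finset.sum_ite_irrel, Finset.sum_ite_eq', Finset.sum_const_zero, Finset.mem_univ,
    if_true]
  exact Finset.sum_congr rfl fun x₁ _ => Finset.sum_congr rfl fun y₁ _ => by ring

lemma condMutualInfo_joint_snd (hV : IsChan V) (hp₂ : p₂ ∈ stdSimplex ℝ S₂)
    (hq₁ : ∀ s, q₁ s ∈ stdSimplex ℝ A₁) (hq₂ : ∀ s, q₂ s ∈ stdSimplex ℝ A₂) :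
    condMutualInfo (joint p₁ p₂ q₁ q₂ V) (fun (_, _, _, x₂, _, _) => x₂)
        (fun (_, _, _, _, _, y₂) => y₂) (fun (s₁, _, _, _, _, _) => s₁) =
      chanInfo p₁ (fun _ a => ∑ s, p₂ s * q₂ s a) (effChan q₁ (swapChan V)) := by
  classical
  refine condMutualInfo_eq_chanInfo (fun z => (mix_mem hp₂ hq₂).2)
    (fun z x => (effChan_mem hV.swap (hq₁ _) x).2) ?_
  intro x y s₁
  simp only [pr, Set.indicator_apply, Set.mem_ofPred_eq, ite_and, joint,
    Fintype.sum_prod_type, effChan, swapChan, Finset.mul_sum, Finset.sum_mul]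
  simp only [Finset.sum_ite_irrel, Finset.sum_ite_eq', Finset.sum_const_zero, Finset.mem_univ,
    if_true]
  rw [Finset.sum_comm]
  refine Finset.sum_congr rfl fun x₁ _ => ?_
  rw [Finset.sum_comm]
  exact Finset.sum_congr rfl fun y₁ _ => Finset.sum_congr rfl fun s₂ _ => by ring


end Joint

/-! ### Lower bounds on mutual information -/

section LowerBounds

variable {Z A B : Type*} [Fintype Z] [Fintype A] [Fintype B] {ν : Z → ℝ} {r : Z → A → ℝ}
  {V : Z → A → B → ℝ}

lemma sum_chan_weight (hν : ν ∈ stdSimplex ℝ Z) (hr : ∀ z, r z ∈ stdSimplex ℝ A)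
    (hV : ∀ z a, V z a ∈ stdSimplex ℝ B) : ∑ z, ∑ a, ∑ b, ν z * r z a * V z a b = 1 := by
  simp_rw [← Finset.mul_sum, (hV _ _).2, mul_one, ← Finset.mul_sum, (hr _).2, mul_one]
  exact hν.2

/-- Variational lower bound on mutual information: a change of measure with density `φ`. -/
lemma le_chanInfo_of_density (hν : ν ∈ stdSimplex ℝ Z) (hr : ∀ z, r z ∈ stdSimplex ℝ A)
    (hV : ∀ z a, V z a ∈ stdSimplex ℝ B) {φ : Z → A → B → ℝ} (hφ : ∀ z a b, 0 < φ z a b)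
    {c : ℝ} (hc : 0 < c)
    (h : ∑ z, ∑ a, ∑ b, ν z * r z a * (∑ a', r z a' * V z a' b) * φ z a b ≤ c) :
    ∑ z, ∑ a, ∑ b, ν z * r z a * V z a b * Real.logb 2 (φ z a b) - Real.logb 2 c ≤
      chanInfo ν r V := by
  have hl2 : 0 < Real.log 2 := Real.log_pos one_lt_two
  -- This is `log t ≤ t - 1` at `t = O φ / (V c)`, weighted by the joint probability. After
  -- summation the linear terms contribute with the right sign because of `h`.
  have key : ∀ z a b, ν z * r z a * V z a b * Real.logb 2 (φ z a b)
      - (ν z * r z a * V z a b) * Real.logb 2 c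
      + (ν z * r z a * V z a b - ν z * r z a * (∑ a', r z a' * V z a' b) * φ z a b / c)
        / Real.log 2
      ≤ ν z * r z a * V z a b * Real.logb 2 (V z a b / ∑ a', r z a' * V z a' b) := by
    intro z a b
    set O := ∑ a', r z a' * V z a' b with hO
    have hOn : 0 ≤ O := Finset.sum_nonneg fun a' _ => mul_nonneg ((hr z).1 _) ((hV z a').1 _)
    have hn : 0 ≤ ν z * r z a := mul_nonneg (hν.1 z) ((hr z).1 a)
    rcases (mul_nonneg hn ((hV z a).1 b)).eq_or_lt with h0 | h0
    · have : 0 ≤ ν z * r z a * O * φ z a b / c :=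
        div_nonneg (mul_nonneg (mul_nonneg hn hOn) (hφ z a b).le) hc.le
      rw [← h0]
      simp only [zero_mul, sub_zero, zero_sub, zero_add]
      exact div_nonpos_of_nonpos_of_nonneg (by linarith) hl2.le
    · have hv : 0 < V z a b := pos_of_mul_pos_right h0 hn
      have hnp : 0 < ν z * r z a := pos_of_mul_pos_left h0 hv.le
      have hra : 0 < r z a := pos_of_mul_pos_right hnp (hν.1 z)
      have hOp : 0 < O := lt_of_lt_of_le (mul_pos hra hv)
        (Finset.single_le_sum (f := fun a' => r z a' * V z a' b)
          (fun a' _ => mul_nonneg ((hr z).1 _) ((hV z a').1 _)) (Finset.mem_univ a))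
      have hq : 0 < O * φ z a b / (V z a b * c) := by have := hφ z a b; positivity
      have hlog := Real.log_le_sub_one_of_pos hq
      rw [Real.log_div (by have := hφ z a b; positivity) (by positivity),
        Real.log_mul hOp.ne' (hφ z a b).ne', Real.log_mul hv.ne' hc.ne'] at hlog
      simp only [Real.logb]
      rw [Real.log_div hv.ne' hOp.ne']
      have h2 : (ν z * r z a * V z a b) * (Real.log (φ z a b) - Real.log c + 1
          - O * φ z a b / (V z a b * c)) ≤
          (ν z * r z a * V z a b) * (Real.log (V z a b) - Real.log O) :=
        mul_le_mul_of_nonneg_left (by linarith) h0.le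
      have h3 : (ν z * r z a * V z a b) * (O * φ z a b / (V z a b * c)) =
          ν z * r z a * O * φ z a b / c := by field_simp
      rw [← sub_nonneg] at h2 ⊢
      have : ∀ x y : ℝ, 0 ≤ x → y * Real.log 2 = x → 0 ≤ y := fun x y hx hy => by
        by_contra! hneg
        nlinarith
      refine this _ _ h2 ?_
      field_simp
      field_simp at h3
      ring
  have hsum := Finset.sum_le_sum fun z (_ : z ∈ Finset.univ) =>
    Finset.sum_le_sum fun a (_ : a ∈ Finset.univ) =>
    Finset.sum_le_sum fun b (_ : b ∈ Finset.univ) => key z a b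
  simp only [Finset.sum_add_distrib, Finset.sum_sub_distrib, ← Finset.sum_div,
    ← Finset.sum_mul] at hsum
  rw [sum_chan_weight hν hr hV] at hsum
  have h4 : 0 ≤ (1 - (∑ z, ∑ a, ∑ b, ν z * r z a * (∑ a', r z a' * V z a' b) * φ z a b) / c)
      / Real.log 2 := by
    refine div_nonneg ?_ hl2.le
    rw [sub_nonneg, div_le_one hc]; exact h
  unfold chanInfo
  linarith

/-- The variational bound with the constant density `1` and `c = 1`. -/
lemma chanInfo_nonneg (hν : ν ∈ stdSimplex ℝ Z) (hr : ∀ z, r z ∈ stdSimplex ℝ A)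
    (hV : ∀ z a, V z a ∈ stdSimplex ℝ B) : 0 ≤ chanInfo ν r V := by
  have h := le_chanInfo_of_density hν hr hV (φ := fun _ _ _ => 1) (fun _ _ _ => one_pos) one_pos ?_
  · simpa using h
  · refine le_of_eq ?_
    simp_rw [mul_one]
    rw [← sum_chan_weight hν hr hV]
    refine Finset.sum_congr rfl fun z _ => ?_
    rw [Finset.sum_comm, Finset.sum_comm (s := (Finset.univ : Finset A))]
    refine Finset.sum_congr rfl fun b _ => ?_
    rw [← Finset.sum_mul, ← Finset.mul_sum, (hr z).2, mul_one, Finset.mul_sum]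
    simp_rw [mul_assoc]

/-- The law of the channel input for a uniform message. -/
def uniformInput {M A : Type*} [Fintype M] [DecidableEq A] (e : M → A) (a : A) : ℝ :=
  ∑ w, if e w = a then (1 / (Fintype.card M : ℝ)) else 0

lemma sum_uniformInput {M : Type*} [Fintype M] [DecidableEq A] (e : M → A) (F : A → ℝ) :
    ∑ a, uniformInput e a * F a = (1 / (Fintype.card M : ℝ)) * ∑ w, F (e w) := by
  unfold uniformInput
  simp_rw [Finset.sum_mul]
  rw [Finset.sum_comm, Finset.mul_sum]
  refine Finset.sum_congr rfl fun w _ => ?_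
  simp

lemma uniformInput_mem {M : Type*} [Fintype M] [Nonempty M] [DecidableEq A] (e : M → A) :
    uniformInput e ∈ stdSimplex ℝ A := by
  refine ⟨fun a => Finset.sum_nonneg fun w _ => by split_ifs <;> positivity, ?_⟩
  have := sum_uniformInput e (fun _ => 1)
  simpa using this

/-- A form of Fano's inequality: `s` is the success probability of the decoder `g`. -/
lemma fano {M : Type*} [Fintype M] [Nonempty M] [DecidableEq M] [DecidableEq A]
    (hν : ν ∈ stdSimplex ℝ Z) (hV : ∀ z a, V z a ∈ stdSimplex ℝ B) (e : Z → M → A)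
    (g : Z → B → M) {s : ℝ}
    (hs : s ≤ ∑ z, ν z * ((1 / (Fintype.card M : ℝ)) *
      ∑ w, ∑ b, if g z b = w then V z (e z w) b else 0)) :
    s * Real.logb 2 (Fintype.card M) - 1 ≤ chanInfo ν (fun z => uniformInput (e z)) V := by
  set m : ℝ := ((Fintype.card M : ℕ) : ℝ) with hm
  have hm1 : 1 ≤ m := by rw [hm]; exact_mod_cast Fintype.card_pos
  have hm0 : 0 < m := by linarith
  have hr : ∀ z, uniformInput (e z) ∈ stdSimplex ℝ A := fun z => uniformInput_mem _
  have hlogm : 0 ≤ Real.logb 2 m := Real.logb_nonneg one_lt_two hm1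
  -- `T z a b` is the posterior probability, given the input `a`, that the message is the decoded
  -- one. Using it instead of an indicator allows encoders that are not injective. The density is `1
  -- + (m - 1) T`.
  set T : Z → A → B → ℝ := fun z a b =>
    (if e z (g z b) = a then 1 / m else 0) / uniformInput (e z) a with hT
  have hle : ∀ z a b, (if e z (g z b) = a then 1 / m else 0) ≤ uniformInput (e z) a := by
    intro z a b
    exact Finset.single_le_sum (f := fun w => if e z w = a then 1 / m else 0)
      (fun w _ => by split_ifs <;> positivity) (Finset.mem_univ (g z b))
  have hi0 : ∀ z a b, 0 ≤ (if e z (g z b) = a then 1 / m else 0) := fun z a b => by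
    split_ifs <;> positivity
  have hT0 : ∀ z a b, 0 ≤ T z a b := fun z a b => div_nonneg (hi0 z a b) ((hr z).1 a)
  have hT1 : ∀ z a b, T z a b ≤ 1 := fun z a b => div_le_one_of_le₀ (hle z a b) ((hr z).1 a)
  have hrT : ∀ z a b, uniformInput (e z) a * T z a b = if e z (g z b) = a then 1 / m else 0 := by
    intro z a b
    -- Where the input has probability zero the quotient is `0` by convention; by `hle` the
    -- numerator vanishes too.
    refine mul_div_cancel_of_imp' fun h0 => le_antisymm (h0 ▸ hle z a b) (hi0 z a b)
  have hφ : ∀ z a b, 0 < 1 + (m - 1) * T z a b := fun z a b => by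
    have := mul_nonneg (sub_nonneg.2 hm1) (hT0 z a b); linarith
  have hmain := le_chanInfo_of_density hν hr hV hφ two_pos ?_
  · refine le_trans ?_ hmain
    rw [Real.logb_self_eq_one one_lt_two]
    refine sub_le_sub_right ?_ 1
    refine (mul_le_mul_of_nonneg_right hs hlogm).trans ?_
    rw [Finset.sum_mul]
    refine Finset.sum_le_sum fun z _ => ?_
    -- Bernoulli's inequality for an exponent in `[0, 1]`: `m ^ T ≤ 1 + (m - 1) T`. It makes the
    -- logarithm of the density at least `T` times `log m`.
    have hconc : ∀ a b, T z a b * Real.logb 2 m ≤ Real.logb 2 (1 + (m - 1) * T z a b) := by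
      intro a b
      have h1 : m ^ (T z a b) ≤ 1 + (m - 1) * T z a b := by
        have := rpow_one_add_le_one_add_mul_self (s := m - 1) (by linarith) (hT0 z a b)
          (hT1 z a b)
        rw [add_sub_cancel] at this
        linarith
      rw [← Real.logb_rpow_eq_mul_logb_of_pos hm0]
      exact Real.logb_le_logb_of_le one_lt_two (Real.rpow_pos_of_pos hm0 _) h1
    have h2 : ∑ a, ∑ b, ν z * uniformInput (e z) a * V z a b * (T z a b * Real.logb 2 m) ≤
        ∑ a, ∑ b, ν z * uniformInput (e z) a * V z a b
          * Real.logb 2 (1 + (m - 1) * T z a b) :=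
      Finset.sum_le_sum fun a _ => Finset.sum_le_sum fun b _ =>
        mul_le_mul_of_nonneg_left (hconc a b)
          (mul_nonneg (mul_nonneg (hν.1 z) ((hr z).1 a)) ((hV z a).1 b))
    refine le_trans (le_of_eq ?_) h2
    have h3 : ∀ a b, ν z * uniformInput (e z) a * V z a b * (T z a b * Real.logb 2 m) =
        ν z * Real.logb 2 m * ((if e z (g z b) = a then 1 / m else 0) * V z a b) := by
      intro a b; rw [← hrT]; ring
    simp_rw [h3, ← Finset.mul_sum]
    rw [Finset.sum_comm]
    conv_rhs => rw [Finset.sum_comm]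
    simp [Finset.mul_sum, Finset.sum_mul]
    exact Finset.sum_congr rfl fun b _ => by ring
  -- Under the product law the posterior `T` has mean `1 / m`, so the density has total mass `1 + (m
  -- - 1) / m ≤ 2`. This is the origin of the one bit lost.
  · have h4 : ∀ z, ∑ a, ∑ b, ν z * uniformInput (e z) a *
        (∑ a', uniformInput (e z) a' * V z a' b) * (1 + (m - 1) * T z a b) =
        ν z * (1 + (m - 1) * (1 / m)) := by
      intro z
      have h5 : ∀ b, ∑ a, uniformInput (e z) a * (1 + (m - 1) * T z a b) =
          1 + (m - 1) * (1 / m) := by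
        intro b
        have : ∀ a, uniformInput (e z) a * (1 + (m - 1) * T z a b) =
            uniformInput (e z) a + (m - 1) * if e z (g z b) = a then 1 / m else 0 := by
          intro a; rw [← hrT]; ring
        simp_rw [this]
        rw [Finset.sum_add_distrib, (hr z).2, ← Finset.mul_sum]
        simp
      rw [Finset.sum_comm]
      have h6 : ∀ b, ∑ a, ν z * uniformInput (e z) a *
        (∑ a', uniformInput (e z) a' * V z a' b) * (1 + (m - 1) * T z a b) =
          ν z * (1 + (m - 1) * (1 / m)) * ∑ a', uniformInput (e z) a' * V z a' b := by
        intro b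
        rw [← h5 b]
        generalize ∑ a', uniformInput (e z) a' * V z a' b = O
        simp only [Finset.mul_sum, Finset.sum_mul]
        exact Finset.sum_congr rfl fun a _ => by ring
      simp_rw [h6, ← Finset.mul_sum]
      rw [Finset.sum_comm]
      simp_rw [← Finset.mul_sum, (hV _ _).2, mul_one, (hr z).2, mul_one]
    simp_rw [h4]
    rw [← Finset.sum_mul, hν.2, one_mul]
    have : (m - 1) * (1 / m) ≤ 1 := by
      rw [mul_one_div, div_le_one hm0]; linarith
    linarith

end LowerBounds

/-! ### Error probability of one receiver -/

section ReceiverError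

variable {A₁ A₂ B₁ B₂ : Type*} [Fintype B₁] [Fintype B₂] {V : A₁ → A₂ → B₁ → B₂ → ℝ}
  {M₁s M₁p M₂s M₂p : ℕ}

/-- Average error probability of Receiver 1, which knows the message `w₂s`. -/
def rxErr (V : A₁ → A₂ → B₁ → B₂ → ℝ) (e₁ : Fin M₁s × Fin M₁p → A₁)
    (e₂ : Fin M₂s × Fin M₂p → A₂) (d : B₁ × Fin M₂s → Fin M₁s × Fin M₁p) : ℝ :=
  (1 / ((M₁s : ℝ) * M₁p * M₂s * M₂p)) * ∑ w₁s, ∑ w₁p, ∑ w₂s, ∑ w₂p, ∑ y₁, ∑ y₂,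
    if d (y₁, w₂s) ≠ (w₁s, w₁p) then V (e₁ (w₁s, w₁p)) (e₂ (w₂s, w₂p)) y₁ y₂ else 0

lemma one_sub_rxErr [NeZero M₁s] [NeZero M₁p] [NeZero M₂s] [NeZero M₂p] (hV : IsChan V)
    (e₁ : Fin M₁s × Fin M₁p → A₁) (e₂ : Fin M₂s × Fin M₂p → A₂)
    (d : B₁ × Fin M₂s → Fin M₁s × Fin M₁p) :
    1 - rxErr V e₁ e₂ d = (1 / ((M₁s : ℝ) * M₁p * M₂s * M₂p)) *
      ∑ w₁s, ∑ w₁p, ∑ w₂s, ∑ w₂p, ∑ y₁, ∑ y₂,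
        if d (y₁, w₂s) = (w₁s, w₁p) then V (e₁ (w₁s, w₁p)) (e₂ (w₂s, w₂p)) y₁ y₂ else 0 := by
  rw [sub_eq_iff_eq_add, rxErr, ← mul_add]
  simp_rw [← Finset.sum_add_distrib]
  have h : ∀ (w₁s : Fin M₁s) (w₁p : Fin M₁p) (w₂s : Fin M₂s) (w₂p : Fin M₂p) y₁ y₂,
      ((if d (y₁, w₂s) = (w₁s, w₁p) then V (e₁ (w₁s, w₁p)) (e₂ (w₂s, w₂p)) y₁ y₂ else 0) +
        if d (y₁, w₂s) ≠ (w₁s, w₁p) then V (e₁ (w₁s, w₁p)) (e₂ (w₂s, w₂p)) y₁ y₂ else 0) =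
      V (e₁ (w₁s, w₁p)) (e₂ (w₂s, w₂p)) y₁ y₂ := by
    intro w₁s w₁p w₂s w₂p y₁ y₂
    by_cases h : d (y₁, w₂s) = (w₁s, w₁p) <;> simp [h]
  simp_rw [h, hV.sum_eq_one]
  have h1 := NeZero.ne M₁s
  have h2 := NeZero.ne M₁p
  have h3 := NeZero.ne M₂s
  have h4 := NeZero.ne M₂p
  simp
  field_simp

/-- Replace the probability of an output under the transmitted codeword by its sum over all inputs.
For fixed messages of user 2 each output decodes to a single pair, so summing over the pairs leaves
the total mass of `|A₁|` output laws. -/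
lemma one_sub_rxErr_mul_le [Fintype A₁] [NeZero M₁s] [NeZero M₁p] [NeZero M₂s] [NeZero M₂p]
    (hV : IsChan V) (e₁ : Fin M₁s × Fin M₁p → A₁) (e₂ : Fin M₂s × Fin M₂p → A₂)
    (d : B₁ × Fin M₂s → Fin M₁s × Fin M₁p) :
    (1 - rxErr V e₁ e₂ d) * ((M₁s : ℝ) * M₁p) ≤ Fintype.card A₁ := by
  have key : ∀ w₂s w₂p, ∑ w₁s, ∑ w₁p, ∑ y₁, ∑ y₂,
      (if d (y₁, w₂s) = (w₁s, w₁p) then V (e₁ (w₁s, w₁p)) (e₂ (w₂s, w₂p)) y₁ y₂ else 0) ≤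
      (Fintype.card A₁ : ℝ) := by
    intro w₂s w₂p
    have h1 : ∀ w₁s w₁p, ∑ y₁, ∑ y₂,
        (if d (y₁, w₂s) = (w₁s, w₁p) then V (e₁ (w₁s, w₁p)) (e₂ (w₂s, w₂p)) y₁ y₂ else 0) ≤
        ∑ a, ∑ y₁, ∑ y₂, if d (y₁, w₂s) = (w₁s, w₁p) then V a (e₂ (w₂s, w₂p)) y₁ y₂ else 0 := by
      intro w₁s w₁p
      refine Finset.single_le_sum (f := fun a => ∑ y₁, ∑ y₂,
        if d (y₁, w₂s) = (w₁s, w₁p) then V a (e₂ (w₂s, w₂p)) y₁ y₂ else 0) (fun a _ => ?_)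
        (Finset.mem_univ _)
      refine Finset.sum_nonneg fun _ _ => Finset.sum_nonneg fun _ _ => ?_
      split_ifs
      exacts [hV.nonneg _ _ _ _, le_rfl]
    refine (Finset.sum_le_sum fun w₁s _ => Finset.sum_le_sum fun w₁p _ => h1 w₁s w₁p).trans
      (le_of_eq ?_)
    rw [← Fintype.sum_prod_type' (f := fun w₁s w₁p => ∑ a, ∑ y₁, ∑ y₂,
      if d (y₁, w₂s) = (w₁s, w₁p) then V a (e₂ (w₂s, w₂p)) y₁ y₂ else 0), Finset.sum_comm]
    simp_rw [Finset.sum_comm (s := (Finset.univ : Finset (Fin M₁s × Fin M₁p)))]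
    simp [hV.sum_eq_one]
  rw [one_sub_rxErr hV]
  have h1 : (0 : ℝ) < M₁s := by exact_mod_cast NeZero.pos M₁s
  have h2 : (0 : ℝ) < M₁p := by exact_mod_cast NeZero.pos M₁p
  have h3 : (0 : ℝ) < M₂s := by exact_mod_cast NeZero.pos M₂s
  have h4 : (0 : ℝ) < M₂p := by exact_mod_cast NeZero.pos M₂p
  have hsum := Finset.sum_le_sum fun w₂s (_ : w₂s ∈ Finset.univ) =>
    Finset.sum_le_sum fun w₂p (_ : w₂p ∈ Finset.univ) => key w₂s w₂p
  have hre : ∀ F : Fin M₁s → Fin M₁p → Fin M₂s → Fin M₂p → ℝ,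
      ∑ w₁s, ∑ w₁p, ∑ w₂s, ∑ w₂p, F w₁s w₁p w₂s w₂p =
      ∑ w₂s, ∑ w₂p, ∑ w₁s, ∑ w₁p, F w₁s w₁p w₂s w₂p := by
    intro F
    rw [← Fintype.sum_prod_type' (f := fun w₁s w₁p => ∑ w₂s, ∑ w₂p, F w₁s w₁p w₂s w₂p),
      Finset.sum_comm]
    refine Finset.sum_congr rfl fun w₂s _ => ?_
    rw [Finset.sum_comm]
    refine Finset.sum_congr rfl fun w₂p _ => ?_
    rw [Fintype.sum_prod_type]
  rw [hre]
  simp only [Finset.sum_const, Finset.card_univ, Fintype.card_fin, nsmul_eq_mul] at hsum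
  rw [div_mul_eq_mul_div, one_mul, div_mul_eq_mul_div, div_le_iff₀ (by positivity)]
  calc _ ≤ (M₂s * (M₂p * (Fintype.card A₁ : ℝ))) * ((M₁s : ℝ) * M₁p) :=
        mul_le_mul_of_nonneg_right hsum (by positivity)
    _ = _ := by ring

end ReceiverError

/-! ### Converse for one receiver -/

section ReceiverConverse

variable {S₁ S₂ A₁ A₂ B₁ B₂ : Type*} [Fintype S₁] [Fintype S₂] [Fintype A₁] [Fintype A₂]
  [Fintype B₁] [Fintype B₂] {V : A₁ → A₂ → B₁ → B₂ → ℝ} {M₁s M₁p M₂s M₂p : ℕ}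
  [NeZero M₁s] [NeZero M₁p] [NeZero M₂s] [NeZero M₂p]
  [DecidableEq S₁] [DecidableEq S₂] [DecidableEq A₁] [DecidableEq A₂]

/-- The law of the channel input given the auxiliary symbol `s`, when `s` encodes the first
message through `ι` and the second message is uniform. -/
def auxInput {S A : Type*} [DecidableEq A] {M N : ℕ} [NeZero M] (ι : Fin M → S)
    (e : Fin M × Fin N → A) (s : S) : A → ℝ :=
  uniformInput fun w => e (Function.invFun ι s, w)

lemma sum_uniformInput_mul_auxInput {S A : Type*} [Fintype S] [Fintype A] [DecidableEq S]
    [DecidableEq A] {M N : ℕ} [NeZero M] {ι : Fin M → S} (hι : ι.Injective)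
    (e : Fin M × Fin N → A) (a : A) :
    ∑ s, uniformInput ι s * auxInput ι e s a = uniformInput e a := by
  rw [sum_uniformInput]
  unfold auxInput uniformInput
  simp_rw [Function.leftInverse_invFun hι _]
  rw [Fintype.sum_prod_type, Finset.mul_sum]
  refine Finset.sum_congr rfl fun i _ => ?_
  rw [Finset.mul_sum]
  refine Finset.sum_congr rfl fun j _ => ?_
  split_ifs <;> simp [mul_comm]

lemma effChan_auxInput {S₂ A₁ A₂ B₁ B₂ : Type*} [Fintype A₂] [Fintype B₂]
    [DecidableEq A₂] {V : A₁ → A₂ → B₁ → B₂ → ℝ} {M₂s M₂p : ℕ} [NeZero M₂s]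
    (ι : Fin M₂s → S₂) (e : Fin M₂s × Fin M₂p → A₂) (s : S₂) (a : A₁) (b : B₁) :
    effChan (auxInput ι e) V s a b = (1 / (M₂p : ℝ)) *
      ∑ w, ∑ b₂, V a (e (Function.invFun ι s, w)) b b₂ := by
  unfold effChan auxInput
  rw [sum_uniformInput (fun w => e (Function.invFun ι s, w)) (fun a₂ => ∑ b₂, V a a₂ b b₂)]
  simp

/-- Fano's inequality for the full message pair, with state the auxiliary symbol of user 2.
Inverting `ι₂` recovers the message `w₂s` that the decoder uses. -/
lemma le_chanInfo_of_rxErr (hV : IsChan V) {ι₁ : Fin M₁s → S₁} (hι₁ : ι₁.Injective)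
    {ι₂ : Fin M₂s → S₂} (hι₂ : ι₂.Injective) (e₁ : Fin M₁s × Fin M₁p → A₁)
    (e₂ : Fin M₂s × Fin M₂p → A₂) (d : B₁ × Fin M₂s → Fin M₁s × Fin M₁p) :
    (1 - rxErr V e₁ e₂ d) * Real.logb 2 (M₁s * M₁p) - 1 ≤
      chanInfo (uniformInput ι₂) (fun _ a => ∑ s, uniformInput ι₁ s * auxInput ι₁ e₁ s a)
        (effChan (auxInput ι₂ e₂) V) := by
  simp_rw [sum_uniformInput_mul_auxInput hι₁]
  have h := fano (s := 1 - rxErr V e₁ e₂ d) (ν := uniformInput ι₂)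
    (V := effChan (auxInput ι₂ e₂) V) (uniformInput_mem ι₂)
    (fun z a => effChan_mem hV (uniformInput_mem _) a) (fun _ => e₁)
    (fun z b => d (b, Function.invFun ι₂ z)) ?_
  · simpa using h
  · refine le_of_eq ?_
    rw [one_sub_rxErr hV, sum_uniformInput]
    simp_rw [Function.leftInverse_invFun hι₂ _, effChan_auxInput,
      Function.leftInverse_invFun hι₂ _, Fintype.sum_prod_type]
    simp only [Fintype.card_fin, Fintype.card_prod, Nat.cast_mul, Finset.mul_sum]
    conv_rhs => rw [Finset.sum_comm]
    refine Finset.sum_congr rfl fun w₁s _ => ?_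
    conv_rhs => rw [Finset.sum_comm]
    refine Finset.sum_congr rfl fun w₁p _ => Finset.sum_congr rfl fun w₂s _ => ?_
    rw [Finset.sum_comm]
    refine Finset.sum_congr rfl fun y₁ _ => ?_
    split_ifs with h
    · simp only [Finset.mul_sum]
      exact Finset.sum_congr rfl fun _ _ => Finset.sum_congr rfl fun _ _ => by
        field_simp
    · simp

/-- Here both common messages are part of the state and only the private message is guessed, by the
second component of the decoder's output. A correct pair has a correct second component, so the
success probability can only grow. -/
lemma le_chanInfo_pair_of_rxErr (hV : IsChan V) {ι₁ : Fin M₁s → S₁} (hι₁ : ι₁.Injective)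
    {ι₂ : Fin M₂s → S₂} (hι₂ : ι₂.Injective) (e₁ : Fin M₁s × Fin M₁p → A₁)
    (e₂ : Fin M₂s × Fin M₂p → A₂) (d : B₁ × Fin M₂s → Fin M₁s × Fin M₁p) :
    (1 - rxErr V e₁ e₂ d) * Real.logb 2 M₁p - 1 ≤
      chanInfo (fun z : S₁ × S₂ => uniformInput ι₁ z.1 * uniformInput ι₂ z.2)
        (fun z => auxInput ι₁ e₁ z.1) (fun z => effChan (auxInput ι₂ e₂) V z.2) := by
  have h := fano (s := 1 - rxErr V e₁ e₂ d) (V := fun z : S₁ × S₂ => effChan (auxInput ι₂ e₂) V z.2)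
    (prod_weight_mem (uniformInput_mem ι₁) (uniformInput_mem ι₂))
    (fun z a => effChan_mem hV (uniformInput_mem _) a)
    (fun z w => e₁ (Function.invFun ι₁ z.1, w))
    (fun z b => (d (b, Function.invFun ι₂ z.2)).2) ?_
  · simpa [auxInput] using h
  · rw [one_sub_rxErr hV, Fintype.sum_prod_type]
    simp_rw [mul_assoc, ← Finset.mul_sum]
    rw [sum_uniformInput]
    simp_rw [sum_uniformInput]
    simp_rw [Function.leftInverse_invFun hι₂ _, effChan_auxInput,
      Function.leftInverse_invFun hι₂ _, Function.leftInverse_invFun hι₁ _]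
    simp only [Fintype.card_fin, Finset.mul_sum]
    refine Finset.sum_le_sum fun w₁s _ => ?_
    rw [Finset.sum_comm]
    refine Finset.sum_le_sum fun w₂s _ => Finset.sum_le_sum fun w₁p _ => ?_
    rw [Finset.sum_comm]
    refine Finset.sum_le_sum fun y₁ _ => ?_
    by_cases h : d (y₁, w₂s) = (w₁s, w₁p)
    · simp only [h, if_true, Finset.mul_sum]
      refine le_of_eq (Finset.sum_congr rfl fun _ _ => Finset.sum_congr rfl fun _ _ => ?_)
      field_simp
    · simp only [h, if_false, mul_zero, Finset.sum_const_zero]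
      split_ifs
      · have h0 : 0 ≤ ∑ w₂p, ∑ y₂, 1 / (M₂p : ℝ) * V (e₁ (w₁s, w₁p)) (e₂ (w₂s, w₂p)) y₁ y₂ :=
          Finset.sum_nonneg fun _ _ => Finset.sum_nonneg fun _ _ =>
            mul_nonneg (by positivity) (hV.nonneg _ _ _ _)
        positivity
      · simp

end ReceiverConverse

/-! ### Converse -/

section Converse

variable {X₁ X₂ Y₁ Y₂ : Type*} [Fintype Y₁] [Fintype Y₂]

lemma isChan_block (W : Channel X₁ X₂ Y₁ Y₂) (n : ℕ) : IsChan (W.block n) where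
  nonneg _ _ _ _ := Finset.prod_nonneg fun _ _ => (W.prob_mem _ _).1 _
  sum_eq_one x₁ x₂ := by
    unfold Channel.block
    rw [← Fintype.sum_prod_type' (f := fun (y₁ : Fin n → Y₁) (y₂ : Fin n → Y₂) =>
      ∏ i, W.prob (x₁ i) (x₂ i) (y₁ i, y₂ i)),
      ← Equiv.sum_comp (Equiv.arrowProdEquivProdArrow (Fin n) (fun _ => Y₁) (fun _ => Y₂))]
    simp only [Equiv.arrowProdEquivProdArrow_apply, Prod.mk.eta]
    rw [sum_prod_pi (fun i y => W.prob (x₁ i) (x₂ i) y)]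
    exact Finset.prod_eq_one fun i _ => (W.prob_mem _ _).2

variable {M₁s M₁p M₂s M₂p n : ℕ}

lemma rxErr_fst_le_errorProb (W : Channel X₁ X₂ Y₁ Y₂)
    (c : Code X₁ X₂ Y₁ Y₂ M₁s M₁p M₂s M₂p n) :
    rxErr (W.block n) c.enc₁ c.enc₂ c.dec₁ ≤ c.errorProb W := by
  unfold rxErr Code.errorProb
  refine mul_le_mul_of_nonneg_left ?_ (by positivity)
  refine Finset.sum_le_sum fun _ _ => Finset.sum_le_sum fun _ _ => Finset.sum_le_sum fun _ _ =>
    Finset.sum_le_sum fun _ _ => Finset.sum_le_sum fun _ _ => Finset.sum_le_sum fun _ _ => ?_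
  split_ifs with h1 h2 h2
  · exact le_rfl
  · exact absurd (Or.inl h1) h2
  · exact (isChan_block W n).nonneg _ _ _ _
  · exact le_rfl

lemma rxErr_snd_eq (V : (Fin n → X₁) → (Fin n → X₂) → (Fin n → Y₁) → (Fin n → Y₂) → ℝ)
    (c : Code X₁ X₂ Y₁ Y₂ M₁s M₁p M₂s M₂p n) :
    rxErr (swapChan V) c.enc₂ c.enc₁ c.dec₂ = (1 / ((M₁s : ℝ) * M₁p * M₂s * M₂p)) *
      ∑ w₁s, ∑ w₁p, ∑ w₂s, ∑ w₂p, ∑ y₁, ∑ y₂, if c.dec₂ (y₂, w₁s) ≠ (w₂s, w₂p) then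
        V (c.enc₁ (w₁s, w₁p)) (c.enc₂ (w₂s, w₂p)) y₁ y₂ else 0 := by
  unfold rxErr swapChan
  congr 1
  · ring
  · rw [← Fintype.sum_prod_type' (f := fun w₂s w₂p => ∑ w₁s, ∑ w₁p, ∑ y₂, ∑ y₁,
      if c.dec₂ (y₂, w₁s) ≠ (w₂s, w₂p) then
        V (c.enc₁ (w₁s, w₁p)) (c.enc₂ (w₂s, w₂p)) y₁ y₂ else 0), Finset.sum_comm]
    refine Finset.sum_congr rfl fun w₁s _ => ?_
    rw [Finset.sum_comm]
    refine Finset.sum_congr rfl fun w₁p _ => ?_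
    rw [Fintype.sum_prod_type]
    exact Finset.sum_congr rfl fun _ _ => Finset.sum_congr rfl fun _ _ => Finset.sum_comm

lemma rxErr_snd_le_errorProb (W : Channel X₁ X₂ Y₁ Y₂)
    (c : Code X₁ X₂ Y₁ Y₂ M₁s M₁p M₂s M₂p n) :
    rxErr (swapChan (W.block n)) c.enc₂ c.enc₁ c.dec₂ ≤ c.errorProb W := by
  rw [rxErr_snd_eq]
  unfold Code.errorProb
  refine mul_le_mul_of_nonneg_left ?_ (by positivity)
  refine Finset.sum_le_sum fun _ _ => Finset.sum_le_sum fun _ _ => Finset.sum_le_sum fun _ _ =>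
    Finset.sum_le_sum fun _ _ => Finset.sum_le_sum fun _ _ => Finset.sum_le_sum fun _ _ => ?_
  split_ifs with h1 h2 h2
  · exact le_rfl
  · exact absurd (Or.inr h1) h2
  · exact (isChan_block W n).nonneg _ _ _ _
  · exact le_rfl

lemma numMsg_pos (n : ℕ) (R : ℝ) : 0 < numMsg n R :=
  Nat.ceil_pos.2 (Real.rpow_pos_of_pos two_pos _)

instance (n : ℕ) (R : ℝ) : NeZero (numMsg n R) := ⟨(numMsg_pos n R).ne'⟩

lemma mul_le_logb_numMsg (n : ℕ) (R : ℝ) : n * R ≤ Real.logb 2 (numMsg n R) := by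
  rw [Real.le_logb_iff_rpow_le one_lt_two (by exact_mod_cast numMsg_pos n R)]
  exact Nat.le_ceil _

/-- If `q < a`, then `(q / a) ^ n` tends to zero and beats the factor `2`. An asymptotic bound with
a constant thus becomes an exact comparison of bases. -/
lemma le_of_eventually_pow_le {a q : ℝ} (hq : 0 ≤ q) (h : ∀ᶠ n : ℕ in atTop, a ^ n ≤ 2 * q ^ n) :
    a ≤ q := by
  by_contra! hlt
  have ha : 0 < a := hq.trans_lt hlt
  have h1 : Tendsto (fun n : ℕ => 2 * (q / a) ^ n) atTop (𝓝 (2 * 0)) :=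
    (tendsto_pow_atTop_nhds_zero_of_lt_one (by positivity) ((div_lt_one ha).2 hlt)).const_mul 2
  rw [mul_zero] at h1
  obtain ⟨n, hn1, hn2⟩ := (h.and (h1.eventually_lt_const one_pos)).exists
  rw [div_pow, ← mul_div_assoc, div_lt_one (by positivity)] at hn2
  linarith

/-- Vanishing error probability forces each message set to be no larger than the set of input
sequences. -/
lemma numMsg_le_card_pow {q : ℕ} {R : ℝ} (h : ∀ᶠ n : ℕ in atTop, (numMsg n R : ℝ) ≤ 2 * (q : ℝ) ^ n)
    (n : ℕ) : numMsg n R ≤ q ^ n := by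
  have hpow : ∀ n : ℕ, (2 : ℝ) ^ ((n : ℝ) * R) = ((2 : ℝ) ^ R) ^ n := fun n => by
    rw [mul_comm, Real.rpow_mul two_pos.le, Real.rpow_natCast]
  have h2 : (2 : ℝ) ^ R ≤ q := by
    refine le_of_eventually_pow_le (by positivity) (h.mono fun n hn => ?_)
    rw [← hpow]
    exact (Nat.le_ceil _).trans hn
  -- Since `q ^ n` is an integer, the ceiling costs nothing, and the bound holds for every `n`.
  refine Nat.ceil_le.2 ?_
  rw [hpow]
  push_cast
  exact pow_le_pow_left₀ (by positivity) h2 n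

/-- A joint loss `d` in the sum rate is covered when each rate is reduced by `d` and cut off at
zero. -/
lemma sum_max_le {u v d J : ℝ} (hd : 0 ≤ d) (hu : 0 ≤ u) (hv : 0 ≤ v) (hJ : 0 ≤ J)
    (h : u + v - d ≤ J) : max (u - d) 0 + max (v - d) 0 ≤ J := by
  rcases max_cases (u - d) 0 with h1 | h1 <;> rcases max_cases (v - d) 0 with h2 | h2 <;>
    linarith

variable [Fintype X₁] [Fintype X₂]

/-- Slightly reduced rates of a code of block length `n` lie in the `n`-letter region. -/
lemma reduced_rates_mem {S₁ S₂ : Type*} [Fintype S₁] [Fintype S₂] (W : Channel X₁ X₂ Y₁ Y₂)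
    {R₁s R₁p R₂s R₂p : ℝ} (h₁s : 0 ≤ R₁s) (h₁p : 0 ≤ R₁p) (h₂s : 0 ≤ R₂s) (h₂p : 0 ≤ R₂p)
    (hn : 0 < n)
    (c : Code X₁ X₂ Y₁ Y₂ (numMsg n R₁s) (numMsg n R₁p) (numMsg n R₂s) (numMsg n R₂p) n)
    (hM₁ : numMsg n R₁s ≤ Fintype.card S₁ ^ n) (hM₂ : numMsg n R₂s ≤ Fintype.card S₂ ^ n)
    (hpe : c.errorProb W ≤ 1) :
    (max ((1 - c.errorProb W) * R₁s - 1 / n) 0, max ((1 - c.errorProb W) * R₁p - 1 / n) 0,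
      max ((1 - c.errorProb W) * R₂s - 1 / n) 0, max ((1 - c.errorProb W) * R₂p - 1 / n) 0) ∈
      nLetterRegionWith W S₁ S₂ n := by
  classical
  -- The common messages become auxiliary sequences; the cardinality bound is what lets them be
  -- embedded injectively.
  obtain ⟨ι₁⟩ : Nonempty (Fin (numMsg n R₁s) ↪ (Fin n → S₁)) :=
    Function.Embedding.nonempty_of_card_le (by simpa using hM₁)
  obtain ⟨ι₂⟩ : Nonempty (Fin (numMsg n R₂s) ↪ (Fin n → S₂)) :=
    Function.Embedding.nonempty_of_card_le (by simpa using hM₂)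
  have hV := isChan_block W n
  have hn' : (0 : ℝ) < n := by exact_mod_cast hn
  have hp₁ := uniformInput_mem (A := Fin n → S₁) ι₁
  have hp₂ := uniformInput_mem (A := Fin n → S₂) ι₂
  have hq₁ : ∀ s, auxInput ι₁ c.enc₁ s ∈ stdSimplex ℝ (Fin n → X₁) := fun s => uniformInput_mem _
  have hq₂ : ∀ s, auxInput ι₂ c.enc₂ s ∈ stdSimplex ℝ (Fin n → X₂) := fun s => uniformInput_mem _
  have hlog : ∀ {r x J : ℝ}, r ≤ c.errorProb W → 0 ≤ x →
      ∀ {L : ℝ}, n * x ≤ L → (1 - r) * L - 1 ≤ J →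
      (1 - c.errorProb W) * x - 1 / n ≤ 1 / (n : ℝ) * J := by
    intro r x J hr hx L hL hJ
    have h0 : 0 ≤ n * x := by positivity
    have h1 : (1 - c.errorProb W) * (n * x) ≤ (1 - r) * L :=
      mul_le_mul (by linarith) hL h0 (by linarith)
    have h2 : n * ((1 - c.errorProb W) * x - 1 / n) ≤ J := by
      have : n * ((1 - c.errorProb W) * x - 1 / n) = (1 - c.errorProb W) * (n * x) - 1 := by
        field_simp
      linarith
    rw [div_mul_eq_mul_div, one_mul, le_div_iff₀ hn']
    linarith
  have hlog2 : ∀ R R' : ℝ, n * (R + R') ≤ Real.logb 2 (numMsg n R * numMsg n R') := by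
    intro R R'
    rw [Real.logb_mul (NeZero.ne _) (NeZero.ne _)]
    linarith [mul_le_logb_numMsg n R, mul_le_logb_numMsg n R']
  have hd : (0 : ℝ) ≤ 1 / n := by positivity
  have hpe' : 0 ≤ 1 - c.errorProb W := by linarith
  refine ⟨⟨le_max_right _ _, le_max_right _ _, le_max_right _ _, le_max_right _ _⟩,
    uniformInput ι₁, uniformInput ι₂, auxInput ι₁ c.enc₁, auxInput ι₂ c.enc₂, hp₁, hp₂, hq₁, hq₂,
    ?_, ?_, ?_, ?_⟩
  · rw [condMutualInfo_joint_fst_pair hV hq₁ hq₂]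
    refine max_le ?_ (mul_nonneg hd (chanInfo_nonneg (prod_weight_mem hp₁ hp₂) (fun z => hq₁ z.1)
      fun z => effChan_mem hV (hq₂ z.2)))
    exact hlog (rxErr_fst_le_errorProb W c) h₁p (mul_le_logb_numMsg n _)
      (le_chanInfo_pair_of_rxErr hV ι₁.injective ι₂.injective _ _ _)
  · rw [condMutualInfo_joint_fst hV hp₁ hq₁ hq₂]
    refine sum_max_le hd (mul_nonneg hpe' h₁s) (mul_nonneg hpe' h₁p) (mul_nonneg hd
      (chanInfo_nonneg hp₂ (fun _ => mix_mem hp₁ hq₁) fun z => effChan_mem hV (hq₂ z))) ?_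
    rw [← mul_add]
    exact hlog (rxErr_fst_le_errorProb W c) (add_nonneg h₁s h₁p) (hlog2 _ _)
      (le_chanInfo_of_rxErr hV ι₁.injective ι₂.injective _ _ _)
  · rw [condMutualInfo_joint_snd_pair hV hq₁ hq₂]
    refine max_le ?_ (mul_nonneg hd (chanInfo_nonneg (prod_weight_mem hp₂ hp₁) (fun z => hq₂ z.1)
      fun z => effChan_mem hV.swap (hq₁ z.2)))
    exact hlog (rxErr_snd_le_errorProb W c) h₂p (mul_le_logb_numMsg n _)
      (le_chanInfo_pair_of_rxErr hV.swap ι₂.injective ι₁.injective _ _ _)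
  · rw [condMutualInfo_joint_snd hV hp₂ hq₁ hq₂]
    refine sum_max_le hd (mul_nonneg hpe' h₂s) (mul_nonneg hpe' h₂p) (mul_nonneg hd
      (chanInfo_nonneg hp₁ (fun _ => mix_mem hp₂ hq₂) fun z => effChan_mem hV.swap (hq₁ z))) ?_
    rw [← mul_add]
    exact hlog (rxErr_snd_le_errorProb W c) (add_nonneg h₂s h₂p) (hlog2 _ _)
      (le_chanInfo_of_rxErr hV.swap ι₂.injective ι₁.injective _ _ _)

/-- Once the error probability is below `1 / 2`, the counting bound gives at most `2 |X_k| ^ n`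
common messages, and then at most `|X_k| ^ n` for all `n`. The reduced rates lie in the regions for
large `n` and converge to `R`. -/
lemma Achievable.mem_lowerLimit {S₁ S₂ : Type*} [Fintype S₁] [Fintype S₂]
    {W : Channel X₁ X₂ Y₁ Y₂} {R : Rates} (hR : Achievable W R)
    (hS₁ : Fintype.card S₁ = Fintype.card X₁) (hS₂ : Fintype.card S₂ = Fintype.card X₂) :
    R ∈ lowerLimit fun n => nLetterRegionWith W S₁ S₂ n := by
  obtain ⟨R₁s, R₁p, R₂s, R₂p⟩ := R
  obtain ⟨⟨h₁s, h₁p, h₂s, h₂p⟩, c, hc⟩ := hR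
  have hhalf : ∀ᶠ n in atTop, (c n).errorProb W < 1 / 2 :=
    hc.eventually_lt_const (by norm_num)
  have hdouble : ∀ {e M N q : ℝ}, e < 1 / 2 → 1 ≤ M → 1 ≤ N → (1 - e) * (M * N) ≤ q →
      M ≤ 2 * q := by
    intro e M N q he hM hN h
    have : M ≤ M * N := le_mul_of_one_le_right (by linarith) hN
    nlinarith
  have hone : ∀ n R, (1 : ℝ) ≤ numMsg n R := fun n R => by exact_mod_cast numMsg_pos n R
  have hM₁ : ∀ n, numMsg n R₁s ≤ Fintype.card S₁ ^ n := by
    refine numMsg_le_card_pow (hhalf.mono fun n hn => ?_)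
    refine hdouble ((rxErr_fst_le_errorProb W (c n)).trans_lt hn) (hone _ _) (hone _ _)
      ((one_sub_rxErr_mul_le (isChan_block W n) _ _ _).trans (le_of_eq ?_))
    rw [hS₁]; simp
  have hM₂ : ∀ n, numMsg n R₂s ≤ Fintype.card S₂ ^ n := by
    refine numMsg_le_card_pow (hhalf.mono fun n hn => ?_)
    refine hdouble ((rxErr_snd_le_errorProb W (c n)).trans_lt hn) (hone _ _) (hone _ _)
      ((one_sub_rxErr_mul_le (isChan_block W n).swap _ _ _).trans (le_of_eq ?_))
    rw [hS₂]; simp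
  have hlim : ∀ {x : ℝ}, 0 ≤ x → Tendsto
      (fun n : ℕ => max ((1 - (c n).errorProb W) * x - 1 / (n : ℝ)) 0) atTop (𝓝 x) := by
    intro x hx
    have h := ((((tendsto_const_nhds (x := (1 : ℝ))).sub hc).mul_const x).sub
      (tendsto_const_div_atTop_nhds_zero_nat (1 : ℝ))).max (tendsto_const_nhds (x := (0 : ℝ)))
    simpa [max_eq_left hx] using h
  intro U hU
  have hlim' := (hlim h₁s).prodMk_nhds ((hlim h₁p).prodMk_nhds ((hlim h₂s).prodMk_nhds (hlim h₂p)))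
  filter_upwards [hlim'.eventually_mem hU, hhalf, eventually_gt_atTop 0] with n hn1 hn2 hn3
  exact ⟨_, reduced_rates_mem W h₁s h₁p h₂s h₂p hn3 (c n) (hM₁ n) (hM₂ n) (by linarith), hn1⟩

end Converse

/-! ### Random superposition codebooks -/

section Codebook

variable {S A : Type*} [Fintype S] [Fintype A] {Ms Mp : ℕ} {p : S → ℝ} {q : S → A → ℝ}

/-- A superposition codebook: for each first message a cloud centre and, for each second message,
a codeword. -/
abbrev Codebook (S A : Type*) (Ms Mp : ℕ) : Type _ := Fin Ms → S × (Fin Mp → A)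

/-- The encoder of a superposition codebook. -/
def Codebook.enc {S A : Type*} {Ms Mp : ℕ} (c : Codebook S A Ms Mp) (w : Fin Ms × Fin Mp) : A :=
  (c w.1).2 w.2

/-- The law of a cloud centre together with its conditionally independent codewords. -/
def cloudWeight (p : S → ℝ) (q : S → A → ℝ) (x : S × (Fin Mp → A)) : ℝ :=
  p x.1 * ∏ l, q x.1 (x.2 l)

/-- The law of a random superposition codebook. -/
def codebookWeight (p : S → ℝ) (q : S → A → ℝ) (c : Codebook S A Ms Mp) : ℝ :=
  ∏ k, cloudWeight p q (c k)

lemma codebookWeight_nonneg (hp : p ∈ stdSimplex ℝ S) (hq : ∀ s, q s ∈ stdSimplex ℝ A)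
    (c : Codebook S A Ms Mp) : 0 ≤ codebookWeight p q c :=
  Finset.prod_nonneg fun _ _ => mul_nonneg (hp.1 _) (Finset.prod_nonneg fun _ _ => (hq _).1 _)

lemma sum_cloudWeight (hp : p ∈ stdSimplex ℝ S) (hq : ∀ s, q s ∈ stdSimplex ℝ A) :
    ∑ x : S × (Fin Mp → A), cloudWeight p q x = 1 := by
  unfold cloudWeight
  rw [Fintype.sum_prod_type]
  simp_rw [← Finset.mul_sum, sum_pi_weight (hq _).2, mul_one, hp.2]

lemma sum_codebookWeight (hp : p ∈ stdSimplex ℝ S) (hq : ∀ s, q s ∈ stdSimplex ℝ A) :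
    ∑ c : Codebook S A Ms Mp, codebookWeight p q c = 1 :=
  sum_pi_weight (sum_cloudWeight hp hq)

lemma sum_cloudWeight_eval (hq : ∀ s, q s ∈ stdSimplex ℝ A) (h : S → A → ℝ) (l : Fin Mp) :
    ∑ x : S × (Fin Mp → A), cloudWeight p q x * h x.1 (x.2 l) = ∑ s, p s * ∑ a, q s a * h s a := by
  unfold cloudWeight
  rw [Fintype.sum_prod_type]
  simp_rw [mul_assoc, ← Finset.mul_sum, sum_pi_eval (hq _).2]

lemma sum_codebookWeight_eval (hp : p ∈ stdSimplex ℝ S) (hq : ∀ s, q s ∈ stdSimplex ℝ A)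
    (h : S → A → ℝ) (i : Fin Ms) (l : Fin Mp) :
    ∑ c : Codebook S A Ms Mp, codebookWeight p q c * h (c i).1 ((c i).2 l) =
      ∑ s, p s * ∑ a, q s a * h s a := by
  unfold codebookWeight
  rw [sum_pi_eval (sum_cloudWeight hp hq) (fun x => h x.1 (x.2 l)) i, sum_cloudWeight_eval hq]

lemma sum_codebookWeight_eval_same (hp : p ∈ stdSimplex ℝ S) (hq : ∀ s, q s ∈ stdSimplex ℝ A)
    (h : S → A → A → ℝ) (i : Fin Ms) {l l' : Fin Mp} (hl : l ≠ l') :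
    ∑ c : Codebook S A Ms Mp, codebookWeight p q c * h (c i).1 ((c i).2 l) ((c i).2 l') =
      ∑ s, p s * ∑ a, ∑ a', q s a * q s a' * h s a a' := by
  classical
  unfold codebookWeight
  rw [sum_pi_eval (sum_cloudWeight hp hq) (fun x => h x.1 (x.2 l) (x.2 l')) i]
  unfold cloudWeight
  rw [Fintype.sum_prod_type]
  simp_rw [mul_assoc, ← Finset.mul_sum]
  refine Finset.sum_congr rfl fun s _ => ?_
  rw [sum_pi_eval_two (hq s).2 (h s) hl]
  simp_rw [mul_assoc, ← Finset.mul_sum]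

/-- Different clouds are independent, so the competing centre and codeword are averaged
independently of the transmitted codeword. -/
lemma sum_codebookWeight_eval_ne (hp : p ∈ stdSimplex ℝ S) (hq : ∀ s, q s ∈ stdSimplex ℝ A)
    (h : A → S → A → ℝ) {i i' : Fin Ms} (hi : i ≠ i') (l l' : Fin Mp) :
    ∑ c : Codebook S A Ms Mp,
        codebookWeight p q c * h ((c i).2 l) (c i').1 ((c i').2 l') =
      ∑ s, p s * ∑ a, q s a * ∑ s', p s' * ∑ a', q s' a' * h a s' a' := by
  classical
  unfold codebookWeight
  rw [sum_pi_eval_two (sum_cloudWeight hp hq) (fun x x' => h (x.2 l) x'.1 (x'.2 l')) hi]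
  simp_rw [mul_assoc, ← Finset.mul_sum]
  have h1 : ∀ x : S × (Fin Mp → A),
      ∑ x' : S × (Fin Mp → A), cloudWeight p q x' * h (x.2 l) x'.1 (x'.2 l') =
      ∑ s', p s' * ∑ a', q s' a' * h (x.2 l) s' a' := fun x => sum_cloudWeight_eval hq _ l'
  simp_rw [h1]
  exact sum_cloudWeight_eval hq (fun _ a => ∑ s', p s' * ∑ a', q s' a' * h a s' a') l

end Codebook

/-! ### Threshold decoding -/

section Threshold

variable {S S' A B : Type*} [Fintype S] [Fintype S'] [Fintype A] [Fintype B] {Ms Mp : ℕ}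

/-- Both likelihood ratios of the output `y` exceed their thresholds. -/
def IsTypical (p : S → ℝ) (q : S → A → ℝ) (U : S' → A → B → ℝ) (τ₁ τ₂ : ℝ) (s : S) (a : A)
    (s' : S') (y : B) : Prop :=
  τ₁ * ∑ a', q s a' * U s' a' y < U s' a y ∧
    τ₂ * ∑ a', (∑ t, p t * q t a') * U s' a' y < U s' a y

open Classical in
/-- Probability that the transmitted codeword misses one of the thresholds. -/
def atypicalProb (p : S → ℝ) (p' : S' → ℝ) (q : S → A → ℝ) (U : S' → A → B → ℝ) (τ₁ τ₂ : ℝ) : ℝ :=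
  ∑ s, p s * ∑ a, q s a * ∑ s', p' s' * ∑ y, U s' a y *
    if IsTypical p q U τ₁ τ₂ s a s' y then 0 else 1

open Classical in
/-- The decoder that looks for the unique message pair with a typical codeword. -/
def thresholdDec [NeZero Ms] [NeZero Mp] (p : S → ℝ) (q : S → A → ℝ) (U : S' → A → B → ℝ)
    (τ₁ τ₂ : ℝ) (c : Codebook S A Ms Mp) (s' : S') (y : B) : Fin Ms × Fin Mp :=
  if h : ∃ w : Fin Ms × Fin Mp, IsTypical p q U τ₁ τ₂ (c w.1).1 (c.enc w) s' y ∧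
      ∀ w', IsTypical p q U τ₁ τ₂ (c w'.1).1 (c.enc w') s' y → w' = w
  then h.choose else 0

variable {p : S → ℝ} {p' : S' → ℝ} {q : S → A → ℝ} {U : S' → A → B → ℝ} {τ₁ τ₂ : ℝ}

open Classical in
-- Union bound at a fixed codebook and output: an error means that the true codeword is atypical, or
-- that a competitor in the same cloud or in another cloud is typical.
lemma thresholdDec_ne_le {S S' A B : Type*} [Fintype S] [Fintype A] {p : S → ℝ} {q : S → A → ℝ}
    {U : S' → A → B → ℝ} [NeZero Ms] [NeZero Mp] (c : Codebook S A Ms Mp) (s' : S') (y : B)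
    (i : Fin Ms) (l : Fin Mp) :
    (if thresholdDec p q U τ₁ τ₂ c s' y ≠ (i, l) then (1 : ℝ) else 0) ≤
      (if IsTypical p q U τ₁ τ₂ (c i).1 ((c i).2 l) s' y then 0 else 1) +
      ∑ l' ∈ Finset.univ.erase l, (if IsTypical p q U τ₁ τ₂ (c i).1 ((c i).2 l') s' y then 1 else 0) +
      ∑ i' ∈ Finset.univ.erase i, ∑ l',
        (if IsTypical p q U τ₁ τ₂ (c i').1 ((c i').2 l') s' y then 1 else 0) := by
  have h2 : ∀ (T : Finset (Fin Mp)) (j : Fin Ms), (0 : ℝ) ≤ ∑ l' ∈ T,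
      if IsTypical p q U τ₁ τ₂ (c j).1 ((c j).2 l') s' y then 1 else 0 := fun T j =>
    Finset.sum_nonneg fun _ _ => by split_ifs <;> norm_num
  have h3 : (0 : ℝ) ≤ ∑ i' ∈ Finset.univ.erase i, ∑ l',
      (if IsTypical p q U τ₁ τ₂ (c i').1 ((c i').2 l') s' y then 1 else 0) :=
    Finset.sum_nonneg fun _ _ => h2 _ _
  split_ifs with h h1
  · rw [zero_add]
    by_cases hu : ∀ w', IsTypical p q U τ₁ τ₂ (c w'.1).1 (c.enc w') s' y → w' = (i, l)
    · refine absurd ?_ h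
      have hex : ∃ w : Fin Ms × Fin Mp, IsTypical p q U τ₁ τ₂ (c w.1).1 (c.enc w) s' y ∧
          ∀ w', IsTypical p q U τ₁ τ₂ (c w'.1).1 (c.enc w') s' y → w' = w := ⟨(i, l), h1, hu⟩
      rw [thresholdDec, dif_pos hex]
      exact hu _ hex.choose_spec.1
    · push Not at hu
      obtain ⟨⟨i', l'⟩, hT, hne⟩ := hu
      have hT' : (if IsTypical p q U τ₁ τ₂ (c i').1 ((c i').2 l') s' y then (1 : ℝ) else 0) = 1 :=
        if_pos hT
      by_cases hi : i' = i
      · subst hi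
        have hl : l' ∈ Finset.univ.erase l := by
          simp only [Finset.mem_erase, Finset.mem_univ, and_true]
          rintro rfl
          exact hne rfl
        have := Finset.single_le_sum (f := fun l' =>
          (if IsTypical p q U τ₁ τ₂ (c i').1 ((c i').2 l') s' y then (1 : ℝ) else 0))
          (fun _ _ => by split_ifs <;> norm_num) hl
        linarith
      · have h4 := Finset.single_le_sum (f := fun l' =>
          (if IsTypical p q U τ₁ τ₂ (c i').1 ((c i').2 l') s' y then (1 : ℝ) else 0))
          (fun _ _ => by split_ifs <;> norm_num) (Finset.mem_univ l')
        have h5 := Finset.single_le_sum (f := fun i' => ∑ l',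
          (if IsTypical p q U τ₁ τ₂ (c i').1 ((c i').2 l') s' y then (1 : ℝ) else 0))
          (fun _ _ => h2 _ _) (Finset.mem_erase.2 ⟨hi, Finset.mem_univ i'⟩)
        have h6 := h2 (Finset.univ.erase l) i
        linarith
  · have := h2 (Finset.univ.erase l) i
    linarith
  · have := h2 (Finset.univ.erase l) i
    positivity
  · have := h2 (Finset.univ.erase l) i
    positivity

/-- Probability, for the transmitted codeword `a` and a competing codeword `a₁` with cloud centre
`s₁`, that the competitor is typical. -/
def confusionProb (p : S → ℝ) (p' : S' → ℝ) (q : S → A → ℝ) (U : S' → A → B → ℝ) (τ₁ τ₂ : ℝ)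
    (a : A) (s₁ : S) (a₁ : A) : ℝ :=
  open Classical in
  ∑ s', p' s' * ∑ y, U s' a y * if IsTypical p q U τ₁ τ₂ s₁ a₁ s' y then 1 else 0

/-- Change of measure: on the typical set the output law averaged over `r` is below `1 / τ` times
the output law of the competitor, whose total mass is one. It is used with `r` the law within a
cloud and with `r` the overall mixture. -/
lemma sum_confusionProb_le (hp' : p' ∈ stdSimplex ℝ S') (hU : ∀ s' a, U s' a ∈ stdSimplex ℝ B)
    {τ : ℝ} (hτ : 0 < τ) (r : A → ℝ) (s₁ : S) (a₁ : A)
    (h : ∀ s' y, IsTypical p q U τ₁ τ₂ s₁ a₁ s' y → τ * ∑ a, r a * U s' a y < U s' a₁ y) :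
    ∑ a, r a * confusionProb p p' q U τ₁ τ₂ a s₁ a₁ ≤ 1 / τ := by
  classical
  have h1 : ∑ a, r a * confusionProb p p' q U τ₁ τ₂ a s₁ a₁ = ∑ s', p' s' * ∑ y,
      (∑ a, r a * U s' a y) * if IsTypical p q U τ₁ τ₂ s₁ a₁ s' y then 1 else 0 := by
    unfold confusionProb
    simp_rw [Finset.mul_sum, Finset.sum_mul, Finset.mul_sum]
    rw [Finset.sum_comm]
    refine Finset.sum_congr rfl fun s' _ => ?_
    rw [Finset.sum_comm]
    exact Finset.sum_congr rfl fun y _ => Finset.sum_congr rfl fun a _ => by ring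
  rw [h1]
  have h2 : ∀ s', ∑ y, (∑ a, r a * U s' a y) *
      (if IsTypical p q U τ₁ τ₂ s₁ a₁ s' y then 1 else 0) ≤ 1 / τ := by
    intro s'
    have h3 : ∀ y, (∑ a, r a * U s' a y) *
        (if IsTypical p q U τ₁ τ₂ s₁ a₁ s' y then 1 else 0) ≤ U s' a₁ y / τ := by
      intro y
      split_ifs with ht
      · rw [mul_one, le_div_iff₀ hτ]
        linarith [h s' y ht]
      · rw [mul_zero]; exact div_nonneg ((hU s' a₁).1 y) hτ.le
    refine (Finset.sum_le_sum fun y _ => h3 y).trans (le_of_eq ?_)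
    rw [← Finset.sum_div, (hU s' a₁).2]
  refine (Finset.sum_le_sum fun s' _ => mul_le_mul_of_nonneg_left (h2 s') (hp'.1 s')).trans
    (le_of_eq ?_)
  rw [← Finset.sum_mul, hp'.2, one_mul]

/-- Expected error probability of the threshold decoder over the random codebook. -/
lemma expected_error_le [NeZero Ms] [NeZero Mp] (hp : p ∈ stdSimplex ℝ S)
    (hp' : p' ∈ stdSimplex ℝ S') (hq : ∀ s, q s ∈ stdSimplex ℝ A)
    (hU : ∀ s' a, U s' a ∈ stdSimplex ℝ B) (hτ₁ : 0 < τ₁) (hτ₂ : 0 < τ₂) (i : Fin Ms)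
    (l : Fin Mp) :
    ∑ c : Codebook S A Ms Mp, codebookWeight p q c * ∑ s', p' s' * ∑ y, U s' ((c i).2 l) y *
        (if thresholdDec p q U τ₁ τ₂ c s' y ≠ (i, l) then 1 else 0) ≤
      atypicalProb p p' q U τ₁ τ₂ + ((Mp : ℝ) - 1) / τ₁ + ((Ms : ℝ) - 1) * Mp / τ₂ := by
  classical
  set N : S → A → ℝ := fun s a => ∑ s', p' s' * ∑ y, U s' a y *
    if IsTypical p q U τ₁ τ₂ s a s' y then 0 else 1 with hN
  set Q := confusionProb p p' q U τ₁ τ₂ with hQ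
  have hpt : ∀ c : Codebook S A Ms Mp, ∑ s', p' s' * ∑ y, U s' ((c i).2 l) y *
        (if thresholdDec p q U τ₁ τ₂ c s' y ≠ (i, l) then 1 else 0) ≤
      N (c i).1 ((c i).2 l) +
        ∑ l' ∈ Finset.univ.erase l, Q ((c i).2 l) (c i).1 ((c i).2 l') +
        ∑ i' ∈ Finset.univ.erase i, ∑ l', Q ((c i).2 l) (c i').1 ((c i').2 l') := by
    intro c
    have h1 : ∑ s', p' s' * ∑ y, U s' ((c i).2 l) y *
        (if thresholdDec p q U τ₁ τ₂ c s' y ≠ (i, l) then 1 else 0) ≤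
        ∑ s', p' s' * ∑ y, U s' ((c i).2 l) y *
          ((if IsTypical p q U τ₁ τ₂ (c i).1 ((c i).2 l) s' y then 0 else 1) +
          ∑ l' ∈ Finset.univ.erase l,
            (if IsTypical p q U τ₁ τ₂ (c i).1 ((c i).2 l') s' y then 1 else 0) +
          ∑ i' ∈ Finset.univ.erase i, ∑ l',
            (if IsTypical p q U τ₁ τ₂ (c i').1 ((c i').2 l') s' y then 1 else 0)) :=
      Finset.sum_le_sum fun s' _ => mul_le_mul_of_nonneg_left (Finset.sum_le_sum fun y _ =>
        mul_le_mul_of_nonneg_left (thresholdDec_ne_le c s' y i l) ((hU _ _).1 _)) (hp'.1 s')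
    refine h1.trans (le_of_eq ?_)
    simp_rw [mul_add, Finset.sum_add_distrib, mul_add, Finset.sum_add_distrib]
    have h2 : ∀ (T : Finset (Fin Mp)) (j : Fin Ms), ∑ s', p' s' * ∑ y, U s' ((c i).2 l) y *
        ∑ l' ∈ T, (if IsTypical p q U τ₁ τ₂ (c j).1 ((c j).2 l') s' y then 1 else 0) =
        ∑ l' ∈ T, Q ((c i).2 l) (c j).1 ((c j).2 l') := by
      intro T j
      rw [hQ]
      unfold confusionProb
      simp_rw [Finset.mul_sum]
      conv_rhs => rw [Finset.sum_comm]
      refine Finset.sum_congr rfl fun s' _ => ?_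
      rw [Finset.sum_comm]
    congr 1
    · congr 1
      exact h2 _ _
    · simp_rw [← h2]
      simp_rw [Finset.mul_sum (s := Finset.univ.erase i)]
      rw [Finset.sum_comm]
      refine Finset.sum_congr rfl fun s' _ => ?_
      rw [← Finset.mul_sum]
      congr 1
      rw [Finset.sum_comm]
  have hsame : ∀ l' ∈ Finset.univ.erase l, ∑ c : Codebook S A Ms Mp, codebookWeight p q c *
      Q ((c i).2 l) (c i).1 ((c i).2 l') ≤ 1 / τ₁ := by
    intro l' hl'
    rw [sum_codebookWeight_eval_same hp hq (fun s a a' => Q a s a') i (Finset.ne_of_mem_erase hl').symm]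
    have h3 : ∀ s, ∑ a, ∑ a', q s a * q s a' * Q a s a' ≤ 1 / τ₁ := by
      intro s
      rw [Finset.sum_comm]
      have h4 : ∀ a', ∑ a, q s a * q s a' * Q a s a' ≤ q s a' * (1 / τ₁) := by
        intro a'
        have := sum_confusionProb_le (p := p) (q := q) (τ₁ := τ₁) (τ₂ := τ₂) hp' hU hτ₁ (q s) s a'
          (fun s' y h => h.1)
        refine le_trans (le_of_eq ?_) (mul_le_mul_of_nonneg_left this ((hq s).1 a'))
        rw [Finset.mul_sum]
        exact Finset.sum_congr rfl fun a _ => by ring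
      refine (Finset.sum_le_sum fun a' _ => h4 a').trans (le_of_eq ?_)
      rw [← Finset.sum_mul, (hq s).2, one_mul]
    refine (Finset.sum_le_sum fun s _ => mul_le_mul_of_nonneg_left (h3 s) (hp.1 s)).trans
      (le_of_eq ?_)
    rw [← Finset.sum_mul, hp.2, one_mul]
  have hdiff : ∀ i' ∈ Finset.univ.erase i, ∀ l', ∑ c : Codebook S A Ms Mp, codebookWeight p q c *
      Q ((c i).2 l) (c i').1 ((c i').2 l') ≤ 1 / τ₂ := by
    intro i' hi' l'
    rw [sum_codebookWeight_eval_ne hp hq Q (Finset.ne_of_mem_erase hi').symm]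
    have h3 : ∑ s, p s * ∑ a, q s a * ∑ s', p s' * ∑ a', q s' a' * Q a s' a' =
        ∑ s', p s' * ∑ a', q s' a' * ∑ a, (∑ s, p s * q s a) * Q a s' a' := by
      have h6 : ∀ G : A → ℝ, ∑ s, p s * ∑ a, q s a * G a = ∑ a, (∑ s, p s * q s a) * G a := by
        intro G
        simp_rw [Finset.sum_mul, Finset.mul_sum]
        rw [Finset.sum_comm]
        simp_rw [mul_assoc]
      rw [h6]
      generalize (fun a => ∑ s, p s * q s a) = r
      simp_rw [Finset.mul_sum]
      rw [Finset.sum_comm]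
      refine Finset.sum_congr rfl fun s' _ => ?_
      rw [Finset.sum_comm]
      exact Finset.sum_congr rfl fun a' _ => Finset.sum_congr rfl fun a _ => by ring
    rw [h3]
    have h4 : ∀ s' a', ∑ a, (∑ s, p s * q s a) * Q a s' a' ≤ 1 / τ₂ := fun s' a' =>
      sum_confusionProb_le hp' hU hτ₂ _ s' a' (fun _ _ h => h.2)
    refine (Finset.sum_le_sum fun s _ => mul_le_mul_of_nonneg_left (Finset.sum_le_sum fun a _ =>
      mul_le_mul_of_nonneg_left (h4 s a) ((hq s).1 a)) (hp.1 s)).trans (le_of_eq ?_)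
    simp_rw [← Finset.sum_mul, (hq _).2, one_mul]
    rw [← Finset.sum_mul, hp.2, one_mul]
  refine (Finset.sum_le_sum fun c _ => mul_le_mul_of_nonneg_left (hpt c)
    (codebookWeight_nonneg hp hq c)).trans ?_
  simp_rw [mul_add, Finset.sum_add_distrib, Finset.mul_sum]
  -- There are `Mp - 1` competitors in the true cloud and `(Ms - 1) * Mp` in the other clouds. These
  -- exact counts matter when there is only one message.
  refine add_le_add (add_le_add ?_ ?_) ?_
  · rw [sum_codebookWeight_eval hp hq N]
    exact le_rfl
  · rw [Finset.sum_comm]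
    refine (Finset.sum_le_sum hsame).trans (le_of_eq ?_)
    rw [Finset.sum_const, Finset.card_erase_of_mem (Finset.mem_univ _), Finset.card_univ,
      Fintype.card_fin, nsmul_eq_mul, Nat.cast_sub (NeZero.pos Mp), Nat.cast_one, mul_one_div]
  · rw [Finset.sum_comm]
    have h5 : ∀ i' ∈ Finset.univ.erase i, ∑ c : Codebook S A Ms Mp, ∑ l', codebookWeight p q c *
        Q ((c i).2 l) (c i').1 ((c i').2 l') ≤ Mp * (1 / τ₂) := by
      intro i' hi'
      rw [Finset.sum_comm]
      refine (Finset.sum_le_sum fun l' _ => hdiff i' hi' l').trans (le_of_eq ?_)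
      simp
    refine (Finset.sum_le_sum h5).trans (le_of_eq ?_)
    rw [Finset.sum_const, Finset.card_erase_of_mem (Finset.mem_univ _), Finset.card_univ,
      Fintype.card_fin, nsmul_eq_mul, Nat.cast_sub (NeZero.pos Ms), Nat.cast_one]
    ring

end Threshold

/-! ### Existence of good codes -/

section RandomCoding

variable {S₁ S₂ A₁ A₂ B₁ B₂ : Type*} [Fintype S₁] [Fintype S₂] [Fintype A₁] [Fintype A₂]
  [Fintype B₁] [Fintype B₂] {V : A₁ → A₂ → B₁ → B₂ → ℝ} {p₁ : S₁ → ℝ} {p₂ : S₂ → ℝ}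
  {q₁ : S₁ → A₁ → ℝ} {q₂ : S₂ → A₂ → ℝ} {M₁s M₁p M₂s M₂p : ℕ}
  [NeZero M₁s] [NeZero M₁p] [NeZero M₂s] [NeZero M₂p]

/-- The decoder of a receiver that knows the interferer's cloud centre. -/
def sideInfoDec (p₁ : S₁ → ℝ) (q₁ : S₁ → A₁ → ℝ) (U : S₂ → A₁ → B₁ → ℝ) (τ₁ τ₂ : ℝ)
    (c₁ : Codebook S₁ A₁ M₁s M₁p) (c₂ : Codebook S₂ A₂ M₂s M₂p) (z : B₁ × Fin M₂s) :
    Fin M₁s × Fin M₁p :=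
  thresholdDec p₁ q₁ U τ₁ τ₂ c₁ (c₂ z.2).1 z.1

lemma expected_rxErr_le (hV : IsChan V) (hp₁ : p₁ ∈ stdSimplex ℝ S₁) (hp₂ : p₂ ∈ stdSimplex ℝ S₂)
    (hq₁ : ∀ s, q₁ s ∈ stdSimplex ℝ A₁) (hq₂ : ∀ s, q₂ s ∈ stdSimplex ℝ A₂) {τ₁ τ₂ : ℝ}
    (hτ₁ : 0 < τ₁) (hτ₂ : 0 < τ₂) :
    ∑ c₁ : Codebook S₁ A₁ M₁s M₁p, codebookWeight p₁ q₁ c₁ *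
      ∑ c₂ : Codebook S₂ A₂ M₂s M₂p, codebookWeight p₂ q₂ c₂ *
        rxErr V c₁.enc c₂.enc (sideInfoDec p₁ q₁ (effChan q₂ V) τ₁ τ₂ c₁ c₂) ≤
      atypicalProb p₁ p₂ q₁ (effChan q₂ V) τ₁ τ₂ + ((M₁p : ℝ) - 1) / τ₁ +
        ((M₁s : ℝ) - 1) * M₁p / τ₂ := by
  set β := atypicalProb p₁ p₂ q₁ (effChan q₂ V) τ₁ τ₂ + ((M₁p : ℝ) - 1) / τ₁ +
        ((M₁s : ℝ) - 1) * M₁p / τ₂ with hβ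
  have key : ∀ (i : Fin M₁s) (l : Fin M₁p) (j : Fin M₂s) (k : Fin M₂p),
      ∑ c₁ : Codebook S₁ A₁ M₁s M₁p, codebookWeight p₁ q₁ c₁ *
      ∑ c₂ : Codebook S₂ A₂ M₂s M₂p, codebookWeight p₂ q₂ c₂ * ∑ y₁, ∑ y₂,
        (if sideInfoDec p₁ q₁ (effChan q₂ V) τ₁ τ₂ c₁ c₂ (y₁, j) ≠ (i, l) then
          V (c₁.enc (i, l)) (c₂.enc (j, k)) y₁ y₂ else 0) ≤ β := by
    intro i l j k
    refine le_trans (le_of_eq ?_)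
      (expected_error_le hp₁ hp₂ hq₁ (fun s a => effChan_mem hV (hq₂ s) a) hτ₁ hτ₂ i l)
    refine Finset.sum_congr rfl fun c₁ _ => ?_
    congr 1
    unfold sideInfoDec Codebook.enc
    rw [sum_codebookWeight_eval hp₂ hq₂ (fun s a => ∑ y₁, ∑ y₂,
      (if thresholdDec p₁ q₁ (effChan q₂ V) τ₁ τ₂ c₁ s y₁ ≠ (i, l) then
          V ((c₁ i).2 l) a y₁ y₂ else 0)) j k]
    refine Finset.sum_congr rfl fun s _ => ?_
    congr 1
    simp_rw [Finset.mul_sum]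
    rw [Finset.sum_comm]
    refine Finset.sum_congr rfl fun y₁ _ => ?_
    unfold effChan
    split_ifs <;> simp [Finset.mul_sum]
  have hre : ∀ F : Codebook S₁ A₁ M₁s M₁p → Codebook S₂ A₂ M₂s M₂p → Fin M₁s → Fin M₁p →
      Fin M₂s → Fin M₂p → ℝ, ∀ K : ℝ,
      ∑ c₁, codebookWeight p₁ q₁ c₁ * ∑ c₂, codebookWeight p₂ q₂ c₂ *
        (K * ∑ i, ∑ l, ∑ j, ∑ k, F c₁ c₂ i l j k) =
      K * ∑ i, ∑ l, ∑ j, ∑ k, ∑ c₁, codebookWeight p₁ q₁ c₁ * ∑ c₂, codebookWeight p₂ q₂ c₂ *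
        F c₁ c₂ i l j k := by
    intro F K
    have h1 : ∀ G : Codebook S₁ A₁ M₁s M₁p → Codebook S₂ A₂ M₂s M₂p →
        (Fin M₁s × Fin M₁p × Fin M₂s × Fin M₂p) → ℝ,
      ∑ c₁, codebookWeight p₁ q₁ c₁ * ∑ c₂, codebookWeight p₂ q₂ c₂ * (K * ∑ w, G c₁ c₂ w) =
      K * ∑ w, ∑ c₁, codebookWeight p₁ q₁ c₁ * ∑ c₂, codebookWeight p₂ q₂ c₂ * G c₁ c₂ w := by
      intro G
      simp_rw [Finset.mul_sum]
      conv_rhs => rw [Finset.sum_comm]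
      refine Finset.sum_congr rfl fun c₁ _ => ?_
      conv_rhs => rw [Finset.sum_comm]
      exact Finset.sum_congr rfl fun c₂ _ => Finset.sum_congr rfl fun w _ => by ring
    have h2 := h1 fun c₁ c₂ w => F c₁ c₂ w.1 w.2.1 w.2.2.1 w.2.2.2
    simpa only [Fintype.sum_prod_type] using h2
  unfold rxErr
  rw [hre]
  refine (mul_le_mul_of_nonneg_left (Finset.sum_le_sum fun i _ => Finset.sum_le_sum fun l _ =>
    Finset.sum_le_sum fun j _ => Finset.sum_le_sum fun k _ => key i l j k)
    (by positivity)).trans (le_of_eq ?_)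
  have h1 := NeZero.ne M₁s
  have h2 := NeZero.ne M₁p
  have h3 := NeZero.ne M₂s
  have h4 := NeZero.ne M₂p
  simp only [Finset.sum_const, Finset.card_univ, Fintype.card_fin, nsmul_eq_mul]
  field_simp

/-- One-shot achievability with superposition coding and threshold decoding. -/
lemma exists_code_rxErr_le (hV : IsChan V) (hp₁ : p₁ ∈ stdSimplex ℝ S₁)
    (hp₂ : p₂ ∈ stdSimplex ℝ S₂) (hq₁ : ∀ s, q₁ s ∈ stdSimplex ℝ A₁)
    (hq₂ : ∀ s, q₂ s ∈ stdSimplex ℝ A₂) {τ₁ τ₂ τ₃ τ₄ : ℝ} (hτ₁ : 0 < τ₁) (hτ₂ : 0 < τ₂)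
    (hτ₃ : 0 < τ₃) (hτ₄ : 0 < τ₄) :
    ∃ (e₁ : Fin M₁s × Fin M₁p → A₁) (e₂ : Fin M₂s × Fin M₂p → A₂)
      (d₁ : B₁ × Fin M₂s → Fin M₁s × Fin M₁p) (d₂ : B₂ × Fin M₁s → Fin M₂s × Fin M₂p),
      rxErr V e₁ e₂ d₁ + rxErr (swapChan V) e₂ e₁ d₂ ≤
        (atypicalProb p₁ p₂ q₁ (effChan q₂ V) τ₁ τ₂ + ((M₁p : ℝ) - 1) / τ₁ +
          ((M₁s : ℝ) - 1) * M₁p / τ₂) +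
        (atypicalProb p₂ p₁ q₂ (effChan q₁ (swapChan V)) τ₃ τ₄ + ((M₂p : ℝ) - 1) / τ₃ +
          ((M₂s : ℝ) - 1) * M₂p / τ₄) := by
  have h1 := expected_rxErr_le (M₁s := M₁s) (M₁p := M₁p) (M₂s := M₂s) (M₂p := M₂p)
    hV hp₁ hp₂ hq₁ hq₂ hτ₁ hτ₂
  have h2 := expected_rxErr_le (M₁s := M₂s) (M₁p := M₂p) (M₂s := M₁s) (M₂p := M₁p)
    hV.swap hp₂ hp₁ hq₂ hq₁ hτ₃ hτ₄
  have h3 := add_le_add h1 h2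
  simp_rw [Finset.mul_sum] at h3
  -- Both receivers' errors are brought under one average over the same pair of codebooks. Averaging
  -- over `c₁` and then over `c₂` then selects codebooks that serve both receivers at once.
  rw [Finset.sum_comm (s := (Finset.univ : Finset (Codebook S₂ A₂ M₂s M₂p))),
    ← Finset.sum_add_distrib] at h3
  simp_rw [← Finset.sum_add_distrib, mul_left_comm (codebookWeight p₂ q₂ _), ← mul_add,
    ← Finset.mul_sum] at h3
  obtain ⟨c₁, hc₁⟩ := exists_le_of_weighted_sum_le (codebookWeight_nonneg hp₁ hq₁)
    (sum_codebookWeight hp₁ hq₁) h3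
  obtain ⟨c₂, hc₂⟩ := exists_le_of_weighted_sum_le (codebookWeight_nonneg hp₂ hq₂)
    (sum_codebookWeight hp₂ hq₂) hc₁
  exact ⟨_, _, _, _, hc₂⟩

end RandomCoding

/-! ### Product laws -/

section ProductLaws

/-- The law of `b` independent symbols. -/
def powLaw {S : Type*} (b : ℕ) (p : S → ℝ) (s : Fin b → S) : ℝ := ∏ i, p (s i)

/-- `b` independent uses of a kernel. -/
def powKer {S A : Type*} (b : ℕ) (q : S → A → ℝ) (s : Fin b → S) (a : Fin b → A) : ℝ :=
  ∏ i, q (s i) (a i)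

/-- `b` independent uses of an interference channel. -/
def powChan {A₁ A₂ B₁ B₂ : Type*} (b : ℕ) (V : A₁ → A₂ → B₁ → B₂ → ℝ) (a₁ : Fin b → A₁)
    (a₂ : Fin b → A₂) (y₁ : Fin b → B₁) (y₂ : Fin b → B₂) : ℝ :=
  ∏ i, V (a₁ i) (a₂ i) (y₁ i) (y₂ i)

lemma powLaw_mem {S : Type*} [Fintype S] (b : ℕ) {p : S → ℝ} (hp : p ∈ stdSimplex ℝ S) :
    powLaw b p ∈ stdSimplex ℝ (Fin b → S) :=
  ⟨fun _ => Finset.prod_nonneg fun _ _ => hp.1 _, sum_pi_weight hp.2⟩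

lemma powKer_mem {S A : Type*} [Fintype A] (b : ℕ) {q : S → A → ℝ}
    (hq : ∀ s, q s ∈ stdSimplex ℝ A) (s : Fin b → S) : powKer b q s ∈ stdSimplex ℝ (Fin b → A) := by
  refine ⟨fun _ => Finset.prod_nonneg fun _ _ => (hq _).1 _, ?_⟩
  unfold powKer
  rw [sum_prod_pi fun i a => q (s i) a]
  exact Finset.prod_eq_one fun i _ => (hq _).2

lemma sum_pi_prod {ι α β : Type*} [Fintype ι] [DecidableEq ι] [Fintype α] [Fintype β]
    (F : (ι → α) → (ι → β) → ℝ) :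
    ∑ ω : ι → α × β, F (fun i => (ω i).1) (fun i => (ω i).2) = ∑ s, ∑ t, F s t := by
  rw [← Fintype.sum_prod_type', ← Equiv.sum_comp (Equiv.arrowProdEquivProdArrow ι (fun _ => α)
    (fun _ => β))]
  rfl

variable {A₁ A₂ B₁ B₂ : Type*} [Fintype B₂] {V : A₁ → A₂ → B₁ → B₂ → ℝ}

lemma isChan_powChan [Fintype B₁] (hV : IsChan V) (b : ℕ) : IsChan (powChan b V) where
  nonneg _ _ _ _ := Finset.prod_nonneg fun _ _ => hV.nonneg _ _ _ _
  sum_eq_one a₁ a₂ := by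
    unfold powChan
    rw [← sum_pi_prod (fun (y₁ : Fin b → B₁) (y₂ : Fin b → B₂) =>
        ∏ i, V (a₁ i) (a₂ i) (y₁ i) (y₂ i)),
      sum_prod_pi (fun i (y : B₁ × B₂) => V (a₁ i) (a₂ i) y.1 y.2)]
    refine Finset.prod_eq_one fun i _ => ?_
    rw [Fintype.sum_prod_type]
    exact hV.sum_eq_one _ _

lemma effChan_pow {S : Type*} [Fintype A₂] (b : ℕ) (q : S → A₂ → ℝ) (s : Fin b → S)
    (a : Fin b → A₁) (y : Fin b → B₁) :
    effChan (powKer b q) (powChan b V) s a y = ∏ i, effChan q V (s i) (a i) (y i) := by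
  unfold effChan powKer powChan
  rw [← sum_prod_pi (fun i a₂ => q (s i) a₂ * ∑ b₂, V (a i) a₂ (y i) b₂)]
  refine Finset.sum_congr rfl fun a₂ _ => ?_
  rw [Finset.prod_mul_distrib, sum_prod_pi (fun i b₂ => V (a i) (a₂ i) (y i) b₂)]

end ProductLaws

/-! ### Weak law of large numbers for likelihood ratios -/

section WeakLaw

variable {Ω : Type*} [Fintype Ω] {P : Ω → ℝ}

/-- Variance of a sum of independent centred variables: the cross terms vanish. -/
lemma sum_pi_sq_of_centered {b : ℕ} (hP : ∑ ω, P ω = 1) {f : Ω → ℝ} (hf : ∑ ω, P ω * f ω = 0) :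
    ∑ ω : Fin b → Ω, (∏ i, P (ω i)) * (∑ i, f (ω i)) ^ 2 = b * ∑ ω, P ω * f ω ^ 2 := by
  have h1 : ∀ ω : Fin b → Ω, (∏ i, P (ω i)) * (∑ i, f (ω i)) ^ 2 =
      ∑ i, ∑ j, (∏ i, P (ω i)) * (f (ω i) * f (ω j)) := by
    intro ω
    rw [sq, Finset.sum_mul_sum]
    simp_rw [Finset.mul_sum]
  simp_rw [h1]
  rw [Finset.sum_comm]
  have h2 : ∀ i : Fin b, ∑ ω : Fin b → Ω, ∑ j, (∏ i, P (ω i)) * (f (ω i) * f (ω j)) =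
      ∑ ω, P ω * f ω ^ 2 := by
    intro i
    rw [Finset.sum_comm, Finset.sum_eq_single i]
    · rw [sum_pi_eval hP (fun ω => f ω * f ω) i]
      simp_rw [sq]
    · intro j _ hj
      rw [sum_pi_eval_mul hP f f hj.symm, hf, zero_mul]
    · simp
  simp_rw [h2]
  simp

/-- Chebyshev's inequality for the normalized logarithm of a likelihood ratio. -/
lemma sum_prod_le_threshold (hP : P ∈ stdSimplex ℝ Ω) {U O : Ω → ℝ}
    (hpos : ∀ ω, 0 < P ω → 0 < U ω ∧ 0 < O ω) {m γ : ℝ} (hγ : 0 < γ)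
    (hm : ∑ ω, P ω * Real.logb 2 (U ω / O ω) = m) {b : ℕ} (hb : 0 < b) :
    ∑ ω : Fin b → Ω, (∏ i, P (ω i)) *
        (if ∏ i, U (ω i) ≤ (2 : ℝ) ^ ((b : ℝ) * (m - γ)) * ∏ i, O (ω i) then 1 else 0) ≤
      (∑ ω, P ω * (Real.logb 2 (U ω / O ω) - m) ^ 2) / γ ^ 2 / b := by
  set f : Ω → ℝ := fun ω => Real.logb 2 (U ω / O ω) - m with hf
  have hb' : (0 : ℝ) < b := by exact_mod_cast hb
  have hcent : ∑ ω, P ω * f ω = 0 := by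
    simp_rw [hf, mul_sub]
    rw [Finset.sum_sub_distrib, ← Finset.sum_mul, hP.2, hm]; ring
  have hpt : ∀ ω : Fin b → Ω, (∏ i, P (ω i)) *
        (if ∏ i, U (ω i) ≤ (2 : ℝ) ^ ((b : ℝ) * (m - γ)) * ∏ i, O (ω i) then 1 else 0) ≤
      (∏ i, P (ω i)) * (∑ i, f (ω i)) ^ 2 * (1 / (b * γ) ^ 2) := by
    intro ω
    have hn : 0 ≤ ∏ i, P (ω i) := Finset.prod_nonneg fun i _ => hP.1 _
    rw [mul_assoc]
    rcases hn.eq_or_lt with h0 | h0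
    -- Sequences of probability zero are discarded first, because positivity of the likelihoods,
    -- hence the logarithm of their quotient, is only controlled on the support.
    · rw [← h0]; simp
    refine mul_le_mul_of_nonneg_left ?_ hn
    split_ifs with h
    · have hi : ∀ i, 0 < P (ω i) := fun i => (hP.1 _).lt_of_ne fun h' =>
        h0.ne' (Finset.prod_eq_zero (Finset.mem_univ i) h'.symm)
      have hU : 0 < ∏ i, U (ω i) := Finset.prod_pos fun i _ => (hpos _ (hi i)).1
      have hO : 0 < ∏ i, O (ω i) := Finset.prod_pos fun i _ => (hpos _ (hi i)).2
      have h1 : ∑ i, Real.logb 2 (U (ω i) / O (ω i)) ≤ b * (m - γ) := by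
        rw [← Real.logb_prod _ _ fun i _ =>
          (div_pos (hpos _ (hi i)).1 (hpos _ (hi i)).2).ne', Finset.prod_div_distrib,
          Real.logb_le_iff_le_rpow one_lt_two (div_pos hU hO), div_le_iff₀ hO]
        exact h
      have h2 : ∑ i, f (ω i) ≤ -(b * γ) := by
        simp_rw [hf]
        rw [Finset.sum_sub_distrib]
        simp only [Finset.sum_const, Finset.card_univ, Fintype.card_fin, nsmul_eq_mul]
        linarith
      rw [mul_one_div, le_div_iff₀ (by positivity), one_mul]
      have : 0 < b * γ := by positivity
      nlinarith
    · positivity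
  refine (Finset.sum_le_sum fun ω _ => hpt ω).trans (le_of_eq ?_)
  rw [← Finset.sum_mul, sum_pi_sq_of_centered hP.2 hcent, hf]
  field_simp

end WeakLaw

/-! ### The transmitted codeword is typical -/

section Typicality

variable {S S' A B : Type*} [Fintype S] [Fintype S'] [Fintype A] [Fintype B] {p : S → ℝ}
  {p' : S' → ℝ} {q : S → A → ℝ} {U : S' → A → B → ℝ}

/-- Both likelihood ratios are products over independent super-letters, and the means of their
logarithms are the two mutual informations. Falling below either mean by a fixed margin per letter
has probability `O(1 / b)`. -/
lemma tendsto_atypicalProb (hp : p ∈ stdSimplex ℝ S) (hp' : p' ∈ stdSimplex ℝ S')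
    (hq : ∀ s, q s ∈ stdSimplex ℝ A) (hU : ∀ s' a, U s' a ∈ stdSimplex ℝ B) {γ₁ γ₂ : ℝ}
    (hγ₁ : 0 < γ₁) (hγ₂ : 0 < γ₂) :
    Tendsto (fun b : ℕ => atypicalProb (powLaw b p) (powLaw b p') (powKer b q)
        (fun s' a (y : Fin b → B) => ∏ i, U (s' i) (a i) (y i))
        ((2 : ℝ) ^ ((b : ℝ) * (chanInfo (fun z : S × S' => p z.1 * p' z.2) (fun z => q z.1)
          (fun z => U z.2) - γ₁)))
        ((2 : ℝ) ^ ((b : ℝ) * (chanInfo p' (fun _ a => ∑ s, p s * q s a) U - γ₂))))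
      atTop (𝓝 0) := by
  classical
  set I₁ := chanInfo (fun z : S × S' => p z.1 * p' z.2) (fun z => q z.1) (fun z => U z.2) with hI₁
  set I₂ := chanInfo p' (fun _ a => ∑ s, p s * q s a) U with hI₂
  set P : S × A × S' × B → ℝ := fun ω =>
    p ω.1 * (q ω.1 ω.2.1 * (p' ω.2.2.1 * U ω.2.2.1 ω.2.1 ω.2.2.2)) with hPdef
  set L : S × A × S' × B → ℝ := fun ω => U ω.2.2.1 ω.2.1 ω.2.2.2 with hL
  set O₁ : S × A × S' × B → ℝ := fun ω => ∑ a, q ω.1 a * U ω.2.2.1 a ω.2.2.2 with hO₁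
  set O₂ : S × A × S' × B → ℝ := fun ω =>
    ∑ a, (∑ s, p s * q s a) * U ω.2.2.1 a ω.2.2.2 with hO₂
  have hP : P ∈ stdSimplex ℝ (S × A × S' × B) := by
    refine ⟨fun ω => mul_nonneg (hp.1 _) (mul_nonneg ((hq _).1 _) (mul_nonneg (hp'.1 _)
      ((hU _ _).1 _))), ?_⟩
    simp only [hPdef, Fintype.sum_prod_type, ← Finset.mul_sum, (hU _ _).2, hp'.2, (hq _).2, hp.2,
      mul_one]
  have hfac : ∀ ω, 0 < P ω → 0 < p ω.1 ∧ 0 < q ω.1 ω.2.1 ∧ 0 < L ω := by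
    intro ω hω
    have hne := hω.ne'
    simp only [hPdef, mul_ne_zero_iff] at hne
    exact ⟨(hp.1 _).lt_of_ne hne.1.symm, ((hq _).1 _).lt_of_ne hne.2.1.symm,
      ((hU _ _).1 _).lt_of_ne hne.2.2.2.symm⟩
  have hpos₁ : ∀ ω, 0 < P ω → 0 < L ω ∧ 0 < O₁ ω := by
    intro ω hω
    obtain ⟨-, h2, h3⟩ := hfac ω hω
    refine ⟨h3, (mul_pos h2 h3).trans_le ?_⟩
    exact Finset.single_le_sum (f := fun a => q ω.1 a * U ω.2.2.1 a ω.2.2.2)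
      (fun a _ => mul_nonneg ((hq _).1 _) ((hU _ _).1 _)) (Finset.mem_univ _)
  have hpos₂ : ∀ ω, 0 < P ω → 0 < L ω ∧ 0 < O₂ ω := by
    intro ω hω
    obtain ⟨h1, h2, h3⟩ := hfac ω hω
    have h4 : p ω.1 * q ω.1 ω.2.1 ≤ ∑ s, p s * q s ω.2.1 :=
      Finset.single_le_sum (f := fun s => p s * q s ω.2.1)
        (fun s _ => mul_nonneg (hp.1 _) ((hq _).1 _)) (Finset.mem_univ _)
    refine ⟨h3, (mul_pos ((mul_pos h1 h2).trans_le h4) h3).trans_le ?_⟩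
    exact Finset.single_le_sum (f := fun a => (∑ s, p s * q s a) * U ω.2.2.1 a ω.2.2.2)
      (fun a _ => mul_nonneg ((mix_mem hp hq).1 a) ((hU _ _).1 _)) (Finset.mem_univ _)
  have hm₁ : ∑ ω, P ω * Real.logb 2 (L ω / O₁ ω) = I₁ := by
    simp only [hPdef, hL, hO₁, hI₁, chanInfo, Fintype.sum_prod_type]
    refine Finset.sum_congr rfl fun s _ => ?_
    rw [Finset.sum_comm]
    refine Finset.sum_congr rfl fun s' _ => Finset.sum_congr rfl fun a _ =>
      Finset.sum_congr rfl fun y _ => by ring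
  have hm₂ : ∑ ω, P ω * Real.logb 2 (L ω / O₂ ω) = I₂ := by
    simp only [hPdef, hL, hO₂, hI₂, chanInfo, Fintype.sum_prod_type]
    rw [Finset.sum_comm]
    conv_rhs => rw [Finset.sum_comm]
    refine Finset.sum_congr rfl fun a _ => ?_
    rw [Finset.sum_comm]
    refine Finset.sum_congr rfl fun s' _ => ?_
    rw [Finset.sum_comm]
    refine Finset.sum_congr rfl fun y _ => ?_
    rw [Finset.mul_sum, Finset.sum_mul, Finset.sum_mul]
    exact Finset.sum_congr rfl fun s _ => by ring
  set C₁ := (∑ ω, P ω * (Real.logb 2 (L ω / O₁ ω) - I₁) ^ 2) / γ₁ ^ 2 with hC₁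
  set C₂ := (∑ ω, P ω * (Real.logb 2 (L ω / O₂ ω) - I₂) ^ 2) / γ₂ ^ 2 with hC₂
  have hlim : Tendsto (fun b : ℕ => C₁ / b + C₂ / b) atTop (𝓝 0) := by
    simpa using (tendsto_const_div_atTop_nhds_zero_nat C₁).add
      (tendsto_const_div_atTop_nhds_zero_nat C₂)
  refine tendsto_of_tendsto_of_tendsto_of_le_of_le' tendsto_const_nhds hlim
    (Eventually.of_forall fun b => ?_) ?_
  · unfold atypicalProb
    refine Finset.sum_nonneg fun s _ => mul_nonneg ((powLaw_mem b hp).1 _) (Finset.sum_nonneg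
      fun a _ => mul_nonneg ((powKer_mem b hq s).1 _) (Finset.sum_nonneg fun s' _ =>
      mul_nonneg ((powLaw_mem b hp').1 _) (Finset.sum_nonneg fun y _ => mul_nonneg
      (Finset.prod_nonneg fun _ _ => (hU _ _).1 _) ?_)))
    split_ifs <;> norm_num
  · filter_upwards [eventually_gt_atTop 0] with b hb
    refine le_trans ?_ (add_le_add (sum_prod_le_threshold hP hpos₁ hγ₁ hm₁ hb)
      (sum_prod_le_threshold hP hpos₂ hγ₂ hm₂ hb))
    rw [← Finset.sum_add_distrib]
    have hO₁pow : ∀ (s : Fin b → S) (s' : Fin b → S') (y : Fin b → B),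
        ∑ a : Fin b → A, powKer b q s a * ∏ i, U (s' i) (a i) (y i) =
        ∏ i, ∑ a, q (s i) a * U (s' i) a (y i) := by
      intro s s' y
      unfold powKer
      simp_rw [← Finset.prod_mul_distrib]
      rw [sum_prod_pi (fun i a => q (s i) a * U (s' i) a (y i))]
    have hmix : ∀ a : Fin b → A, ∑ s, powLaw b p s * powKer b q s a =
        ∏ i, ∑ s, p s * q s (a i) := by
      intro a
      unfold powLaw powKer
      simp_rw [← Finset.prod_mul_distrib]
      rw [sum_prod_pi (fun i s => p s * q s (a i))]
    have hO₂pow : ∀ (s' : Fin b → S') (y : Fin b → B),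
        ∑ a : Fin b → A, (∑ s, powLaw b p s * powKer b q s a) * ∏ i, U (s' i) (a i) (y i) =
        ∏ i, ∑ a, (∑ s, p s * q s a) * U (s' i) a (y i) := by
      intro s' y
      simp_rw [hmix, ← Finset.prod_mul_distrib]
      rw [sum_prod_pi (fun i a => (∑ s, p s * q s a) * U (s' i) a (y i))]
    unfold atypicalProb IsTypical
    simp_rw [hO₁pow, hO₂pow]
    set τ₁ := (2 : ℝ) ^ ((b : ℝ) * (I₁ - γ₁))
    set τ₂ := (2 : ℝ) ^ ((b : ℝ) * (I₂ - γ₂))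
    -- Sums over sequences of tuples are split, one coordinate at a time, into sums over tuples of
    -- sequences. The claim then reduces to a pointwise union bound over the two thresholds.
    have hω := sum_pi_prod (ι := Fin b) fun (s : Fin b → S) (t : Fin b → A × S' × B) =>
      (∏ i, P (s i, t i)) *
        (if ∏ i, L (s i, t i) ≤ τ₁ * ∏ i, O₁ (s i, t i) then 1 else 0) +
      (∏ i, P (s i, t i)) * (if ∏ i, L (s i, t i) ≤ τ₂ * ∏ i, O₂ (s i, t i) then 1 else 0)
    simp only [Prod.mk.eta] at hω
    rw [hω]
    refine Finset.sum_le_sum fun s _ => ?_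
    have hω := sum_pi_prod (ι := Fin b) fun (a : Fin b → A) (t : Fin b → S' × B) =>
      (∏ i, P (s i, a i, t i)) *
        (if ∏ i, L (s i, a i, t i) ≤ τ₁ * ∏ i, O₁ (s i, a i, t i) then 1 else 0) +
      (∏ i, P (s i, a i, t i)) *
        (if ∏ i, L (s i, a i, t i) ≤ τ₂ * ∏ i, O₂ (s i, a i, t i) then 1 else 0)
    simp only [Prod.mk.eta] at hω
    rw [hω, Finset.mul_sum]
    refine Finset.sum_le_sum fun a _ => ?_
    have hω := sum_pi_prod (ι := Fin b) fun (s' : Fin b → S') (y : Fin b → B) =>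
      (∏ i, P (s i, a i, s' i, y i)) *
        (if ∏ i, L (s i, a i, s' i, y i) ≤ τ₁ * ∏ i, O₁ (s i, a i, s' i, y i) then 1 else 0) +
      (∏ i, P (s i, a i, s' i, y i)) *
        (if ∏ i, L (s i, a i, s' i, y i) ≤ τ₂ * ∏ i, O₂ (s i, a i, s' i, y i) then 1 else 0)
    simp only [Prod.mk.eta] at hω
    rw [hω, Finset.mul_sum, Finset.mul_sum]
    refine Finset.sum_le_sum fun s' _ => ?_
    rw [Finset.mul_sum, Finset.mul_sum, Finset.mul_sum]
    refine Finset.sum_le_sum fun y _ => ?_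
    have hPω : powLaw b p s * (powKer b q s a * (powLaw b p' s' * ∏ i, U (s' i) (a i) (y i))) =
        ∏ i, P (s i, a i, s' i, y i) := by
      simp only [powLaw, powKer, hPdef, Finset.prod_mul_distrib]
    have hn : 0 ≤ ∏ i, P (s i, a i, s' i, y i) := Finset.prod_nonneg fun _ _ => hP.1 _
    rw [← mul_add]
    refine le_trans (le_of_eq ?_) (mul_le_mul_of_nonneg_left (b := if
      (τ₁ * ∏ i, O₁ (s i, a i, s' i, y i) < ∏ i, L (s i, a i, s' i, y i) ∧
        τ₂ * ∏ i, O₂ (s i, a i, s' i, y i) < ∏ i, L (s i, a i, s' i, y i))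
      then (0 : ℝ) else 1) ?_ hn)
    · rw [← hPω]
      ring
    · by_cases h1 : ∏ i, L (s i, a i, s' i, y i) ≤ τ₁ * ∏ i, O₁ (s i, a i, s' i, y i)
      · simp only [h1, not_lt.2 h1, if_true, false_and, if_false]
        split_ifs <;> norm_num
      · by_cases h2 : ∏ i, L (s i, a i, s' i, y i) ≤ τ₂ * ∏ i, O₂ (s i, a i, s' i, y i)
        · simp [h1, h2, not_lt.2 h2]
        · simp [h1, h2, not_le.1 h1, not_le.1 h2]

end Typicality

/-! ### From block codes to codes of arbitrary length -/

section Simulation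

/-- Preprocessing the inputs by `ψ₁, ψ₂` and the outputs by `π₁, π₂` turns `V'` into `V`. -/
def Simulates {A₁ A₂ B₁ B₂ A₁' A₂' B₁' B₂' : Type*} [Fintype B₁] [Fintype B₂] [Fintype B₁']
    [Fintype B₂'] (V' : A₁' → A₂' → B₁' → B₂' → ℝ) (V : A₁ → A₂ → B₁ → B₂ → ℝ) (ψ₁ : A₁ → A₁')
    (ψ₂ : A₂ → A₂') (π₁ : B₁' → B₁) (π₂ : B₂' → B₂) : Prop :=
  ∀ (a₁ : A₁) (a₂ : A₂) (F : B₁ → B₂ → ℝ),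
    ∑ y₁, ∑ y₂, V' (ψ₁ a₁) (ψ₂ a₂) y₁ y₂ * F (π₁ y₁) (π₂ y₂) = ∑ y₁, ∑ y₂, V a₁ a₂ y₁ y₂ * F y₁ y₂

variable {A₁ A₂ B₁ B₂ A₁' A₂' B₁' B₂' : Type*} [Fintype B₁] [Fintype B₂] [Fintype B₁']
  [Fintype B₂'] {V' : A₁' → A₂' → B₁' → B₂' → ℝ} {V : A₁ → A₂ → B₁ → B₂ → ℝ} {ψ₁ : A₁ → A₁'}
  {ψ₂ : A₂ → A₂'} {π₁ : B₁' → B₁} {π₂ : B₂' → B₂}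

lemma Simulates.swap (h : Simulates V' V ψ₁ ψ₂ π₁ π₂) :
    Simulates (swapChan V') (swapChan V) ψ₂ ψ₁ π₂ π₁ := by
  intro a₂ a₁ F
  have := h a₁ a₂ fun y₁ y₂ => F y₂ y₁
  unfold swapChan
  rw [Finset.sum_comm, this, Finset.sum_comm]

/-- Processing before the encoders' outputs enter the channel and before the decoders can be
absorbed into the code, so a code for `V` is a code for `V'` with the same error. -/
lemma Simulates.rxErr_eq (h : Simulates V' V ψ₁ ψ₂ π₁ π₂) {M₁s M₁p M₂s M₂p : ℕ}
    (e₁ : Fin M₁s × Fin M₁p → A₁) (e₂ : Fin M₂s × Fin M₂p → A₂)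
    (d : B₁ × Fin M₂s → Fin M₁s × Fin M₁p) :
    rxErr V' (fun w => ψ₁ (e₁ w)) (fun w => ψ₂ (e₂ w)) (fun z => d (π₁ z.1, z.2)) =
      rxErr V e₁ e₂ d := by
  unfold rxErr
  congr 1
  refine Finset.sum_congr rfl fun i _ => Finset.sum_congr rfl fun l _ =>
    Finset.sum_congr rfl fun j _ => Finset.sum_congr rfl fun k _ => ?_
  simpa only [mul_ite, mul_one, mul_zero] using
    h (e₁ (i, l)) (e₂ (j, k)) fun y₁ _ => if d (y₁, j) ≠ (i, l) then 1 else 0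

end Simulation

/-! ### Padding block codes to arbitrary lengths, and the union bound over the receivers -/

section BlockCodes

/-- Coordinates on which `F` does not depend are summed out, each contributing a factor one. -/
lemma sum_prod_restrict {ι K K' α : Type*} [Fintype ι] [DecidableEq ι] [Fintype K] [DecidableEq K]
    [Fintype K'] [DecidableEq K'] [Fintype α] (σ : K ⊕ K' ≃ ι) {g : ι → α → ℝ}
    (hg : ∀ i, ∑ a, g i a = 1) (F : (K → α) → ℝ) :
    ∑ f : ι → α, (∏ i, g i (f i)) * F (fun k => f (σ (Sum.inl k))) =
      ∑ u : K → α, (∏ k, g (σ (Sum.inl k)) (u k)) * F u := by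
  rw [← Equiv.sum_comp ((Equiv.sumArrowEquivProdArrow K K' α).symm.trans
    (σ.arrowCongr (Equiv.refl α))), Fintype.sum_prod_type]
  refine Finset.sum_congr rfl fun u _ => ?_
  simp_rw [← Equiv.prod_comp σ, Fintype.prod_sum_type]
  simp only [Equiv.trans_apply, Equiv.arrowCongr_apply, Equiv.coe_refl, Function.comp_apply, id_eq,
    Equiv.symm_apply_apply, Equiv.sumArrowEquivProdArrow_symm_apply_inl,
    Equiv.sumArrowEquivProdArrow_symm_apply_inr]
  rw [← Finset.sum_mul, ← Finset.mul_sum, sum_prod_pi (fun k a => g (σ (Sum.inr k)) a)]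
  simp [hg]

variable {X₁ X₂ Y₁ Y₂ : Type*} [Fintype Y₁] [Fintype Y₂] {N b n r : ℕ}

/-- The input sequence of length `N` whose first `b n` letters are given in `b` blocks. -/
def padInput {X : Type*} (σ : (Fin b × Fin n) ⊕ Fin r ≃ Fin N) (x₀ : X) (a : Fin b → Fin n → X) :
    Fin N → X :=
  fun i => Sum.elim (fun k => a k.1 k.2) (fun _ => x₀) (σ.symm i)

/-- The `b` blocks of an output sequence of length `N`. -/
def outputBlocks {Y : Type*} (σ : (Fin b × Fin n) ⊕ Fin r ≃ Fin N) (y : Fin N → Y) :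
    Fin b → Fin n → Y :=
  fun j k => y (σ (Sum.inl (j, k)))

/-- The channel is memoryless, so outputs at the padded positions can be ignored, and any bijection
`σ` may place the blocks. -/
lemma simulates_powChan (W : Channel X₁ X₂ Y₁ Y₂) (σ : (Fin b × Fin n) ⊕ Fin r ≃ Fin N) (x₁ : X₁)
    (x₂ : X₂) :
    Simulates (W.block N) (powChan b (W.block n)) (padInput σ x₁) (padInput σ x₂) (outputBlocks σ)
      (outputBlocks σ) := by
  intro a₁ a₂ F
  rw [← sum_pi_prod (fun y₁ y₂ => W.block N (padInput σ x₁ a₁) (padInput σ x₂ a₂) y₁ y₂ *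
    F (outputBlocks σ y₁) (outputBlocks σ y₂))]
  have h := sum_prod_restrict σ (g := fun i => W.prob (padInput σ x₁ a₁ i) (padInput σ x₂ a₂ i))
    (fun i => (W.prob_mem _ _).2)
    (fun u => F (fun j k => (u (j, k)).1) fun j k => (u (j, k)).2)
  refine h.trans ?_
  refine (sum_pi_prod fun (u₁ : Fin b × Fin n → Y₁) (u₂ : Fin b × Fin n → Y₂) =>
    (∏ k, W.prob (padInput σ x₁ a₁ (σ (Sum.inl k))) (padInput σ x₂ a₂ (σ (Sum.inl k)))
      (u₁ k, u₂ k)) * F (fun j k => u₁ (j, k)) fun j k => u₂ (j, k)).trans ?_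
  rw [← Equiv.sum_comp (Equiv.curry (Fin b) (Fin n) Y₁).symm]
  refine Finset.sum_congr rfl fun y₁ _ => ?_
  rw [← Equiv.sum_comp (Equiv.curry (Fin b) (Fin n) Y₂).symm]
  refine Finset.sum_congr rfl fun y₂ _ => ?_
  simp [padInput, powChan, Channel.block, Fintype.prod_prod_type, Equiv.curry]

lemma errorProb_le_add (W : Channel X₁ X₂ Y₁ Y₂) {M₁s M₁p M₂s M₂p : ℕ}
    (c : Code X₁ X₂ Y₁ Y₂ M₁s M₁p M₂s M₂p n) :
    c.errorProb W ≤ rxErr (W.block n) c.enc₁ c.enc₂ c.dec₁ +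
      rxErr (swapChan (W.block n)) c.enc₂ c.enc₁ c.dec₂ := by
  rw [rxErr_snd_eq]
  unfold rxErr Code.errorProb
  rw [← mul_add]
  simp_rw [← Finset.sum_add_distrib]
  refine mul_le_mul_of_nonneg_left ?_ (by positivity)
  refine Finset.sum_le_sum fun _ _ => Finset.sum_le_sum fun _ _ => Finset.sum_le_sum fun _ _ =>
    Finset.sum_le_sum fun _ _ => Finset.sum_le_sum fun _ _ => Finset.sum_le_sum fun _ _ => ?_
  have hor : ∀ (a b : Prop) [Decidable a] [Decidable b] (v : ℝ), 0 ≤ v →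
      (if a ∨ b then v else 0) ≤ (if a then v else 0) + (if b then v else 0) := by
    intro a b _ _ v hv
    by_cases ha : a <;> by_cases hb : b <;> simp [ha, hb, hv]
  exact hor _ _ _ ((isChan_block W n).nonneg _ _ _ _)

end BlockCodes

/-! ### Achievability -/

section Achievability

lemma numMsg_zero (N : ℕ) : numMsg N 0 = 1 := by simp [numMsg]

/-- The number of competing messages grows more slowly than the threshold. -/
lemma exists_tendsto_numMsg {n : ℕ} (hn : 0 < n) {ρ ρ' I θ : ℝ} (hρ : 0 ≤ ρ) (hρ' : 0 ≤ ρ')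
    (hI : n * (ρ + ρ') ≤ I) (hθ₀ : 0 < θ) (hθ₁ : θ < 1) :
    ∃ γ > 0, Tendsto (fun N : ℕ => ((numMsg N (θ * ρ) : ℝ) - 1) * numMsg N (θ * ρ') /
      (2 : ℝ) ^ (((N / n : ℕ) : ℝ) * (I - γ))) atTop (𝓝 0) := by
  rcases hρ.eq_or_lt with h0 | h0
  -- At rate zero there is exactly one message and no competitor: the numerator is zero. This covers
  -- `I = 0`, where no threshold could grow.
  · refine ⟨1, one_pos, ?_⟩
    simp [← h0, numMsg_zero]
  have hn' : (0 : ℝ) < n := by exact_mod_cast hn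
  have hI0 : 0 < I := lt_of_lt_of_le (by positivity) hI
  -- With this choice `θ * I = I - 2 * γ`, so half of the slack goes to the threshold and a decay of
  -- `2 ^ (-γ)` per block remains.
  refine ⟨(1 - θ) * I / 2, by have := sub_pos.2 hθ₁; positivity, ?_⟩
  set γ := (1 - θ) * I / 2 with hγ
  have hγ0 : 0 < γ := by have := sub_pos.2 hθ₁; positivity
  have hlim : Tendsto (fun N : ℕ => 2 * (2 : ℝ) ^ (θ * I) * ((2 : ℝ) ^ (-γ)) ^ (N / n)) atTop
      (𝓝 0) := by
    have h1 := (tendsto_pow_atTop_nhds_zero_of_lt_one (r := (2 : ℝ) ^ (-γ)) (by positivity)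
      (Real.rpow_lt_one_of_one_lt_of_neg one_lt_two (by linarith))).comp
      (Nat.tendsto_div_const_atTop hn.ne')
    simpa using h1.const_mul (2 * (2 : ℝ) ^ (θ * I))
  refine squeeze_zero (fun N => ?_) (fun N => ?_) hlim
  · have : (1 : ℝ) ≤ numMsg N (θ * ρ) := by exact_mod_cast numMsg_pos _ _
    have := sub_nonneg.2 this
    positivity
  · have hceil : ∀ x : ℝ, (numMsg N x : ℝ) - 1 ≤ (2 : ℝ) ^ ((N : ℝ) * x) := fun x => by
      have := (Nat.ceil_lt_add_one (Real.rpow_nonneg two_pos.le ((N : ℝ) * x))).le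
      unfold numMsg
      linarith
    have hceil' : (numMsg N (θ * ρ') : ℝ) ≤ 2 * (2 : ℝ) ^ ((N : ℝ) * (θ * ρ')) := by
      have h1 := hceil (θ * ρ')
      have h2 : (1 : ℝ) ≤ (2 : ℝ) ^ ((N : ℝ) * (θ * ρ')) :=
        Real.one_le_rpow one_le_two (by positivity)
      linarith
    -- The incomplete last block carries rate but no information; it costs only the constant factor
    -- `2 ^ (θ * I)`.
    have hN : (N : ℝ) ≤ n * ((N / n : ℕ) + 1) := by
      exact_mod_cast (Nat.lt_mul_div_succ N hn).le
    have hexp : (N : ℝ) * (θ * ρ) + N * (θ * ρ') ≤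
        θ * I + ((N / n : ℕ) : ℝ) * (I - γ) + -γ * ((N / n : ℕ) : ℝ) := by
      have h1 : (N : ℝ) * (θ * (ρ + ρ')) ≤ n * ((N / n : ℕ) + 1) * (θ * (ρ + ρ')) :=
        mul_le_mul_of_nonneg_right hN (by positivity)
      have h2 : θ * ((N / n : ℕ) + 1) * (n * (ρ + ρ')) ≤ θ * ((N / n : ℕ) + 1) * I :=
        mul_le_mul_of_nonneg_left hI (by positivity)
      rw [hγ]
      linarith
    rw [div_le_iff₀ (by positivity), ← Real.rpow_natCast ((2 : ℝ) ^ (-γ)), ← Real.rpow_mul two_pos.le]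
    calc ((numMsg N (θ * ρ) : ℝ) - 1) * numMsg N (θ * ρ')
        ≤ (2 : ℝ) ^ ((N : ℝ) * (θ * ρ)) * (2 * (2 : ℝ) ^ ((N : ℝ) * (θ * ρ'))) :=
          mul_le_mul (hceil _) hceil' (by positivity) (by positivity)
      _ = 2 * (2 : ℝ) ^ ((N : ℝ) * (θ * ρ) + N * (θ * ρ')) := by
          rw [Real.rpow_add two_pos]; ring
      _ ≤ 2 * (2 : ℝ) ^ (θ * I + ((N / n : ℕ) : ℝ) * (I - γ) + -γ * ((N / n : ℕ) : ℝ)) := by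
          gcongr
          exact one_le_two
      _ = _ := by rw [Real.rpow_add two_pos, Real.rpow_add two_pos]; ring

lemma exists_tendsto_error_bound {S S' A B : Type*} [Fintype S] [Fintype S'] [Fintype A] [Fintype B]
    {p : S → ℝ} {p' : S' → ℝ} {q : S → A → ℝ} {U : S' → A → B → ℝ} (hp : p ∈ stdSimplex ℝ S)
    (hp' : p' ∈ stdSimplex ℝ S') (hq : ∀ s, q s ∈ stdSimplex ℝ A)
    (hU : ∀ s' a, U s' a ∈ stdSimplex ℝ B) {n : ℕ} (hn : 0 < n) {Rs Rp θ : ℝ} (hRs : 0 ≤ Rs)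
    (hRp : 0 ≤ Rp) (hθ₀ : 0 < θ) (hθ₁ : θ < 1)
    (h₁ : Rp ≤ 1 / (n : ℝ) * chanInfo (fun z : S × S' => p z.1 * p' z.2) (fun z => q z.1)
      (fun z => U z.2))
    (h₂ : Rs + Rp ≤ 1 / (n : ℝ) * chanInfo p' (fun _ a => ∑ s, p s * q s a) U) :
    ∃ τ₁ τ₂ ε : ℕ → ℝ, (∀ N, 0 < τ₁ N) ∧ (∀ N, 0 < τ₂ N) ∧ Tendsto ε atTop (𝓝 0) ∧
      ∀ N, atypicalProb (powLaw (N / n) p) (powLaw (N / n) p') (powKer (N / n) q)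
        (fun s' a (y : Fin (N / n) → B) => ∏ i, U (s' i) (a i) (y i)) (τ₁ N) (τ₂ N) +
        ((numMsg N (θ * Rp) : ℝ) - 1) / τ₁ N +
        ((numMsg N (θ * Rs) : ℝ) - 1) * numMsg N (θ * Rp) / τ₂ N = ε N := by
  have hn' : (0 : ℝ) < n := by exact_mod_cast hn
  rw [div_mul_eq_mul_div, one_mul, le_div_iff₀ hn', mul_comm] at h₁ h₂
  -- The private constraint is the case of second rate zero, where the second message count equals
  -- one.
  rw [← add_zero Rp] at h₁
  obtain ⟨γ₁, hγ₁, hlim₁⟩ := exists_tendsto_numMsg hn hRp le_rfl h₁ hθ₀ hθ₁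
  obtain ⟨γ₂, hγ₂, hlim₂⟩ := exists_tendsto_numMsg hn hRs hRp h₂ hθ₀ hθ₁
  simp only [mul_zero, numMsg_zero, Nat.cast_one, mul_one] at hlim₁
  have h := (((tendsto_atypicalProb hp hp' hq hU hγ₁ hγ₂).comp
    (Nat.tendsto_div_const_atTop hn.ne')).add hlim₁).add hlim₂
  rw [add_zero, add_zero] at h
  exact ⟨_, _, _, fun N => Real.rpow_pos_of_pos two_pos _,
    fun N => Real.rpow_pos_of_pos two_pos _, h, fun N => rfl⟩

lemma nonempty_of_stdSimplex {α : Type*} [Fintype α] {p : α → ℝ} (hp : p ∈ stdSimplex ℝ α) :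
    Nonempty α := by
  by_contra h
  rw [not_nonempty_iff] at h
  simpa using hp.2

/-- Supplies the letter used for padding; the existence of probability laws on `Fin n → X` with `n >
0` rules out an empty alphabet. -/
lemma nonempty_letter {S X : Type*} [Fintype S] [Fintype X] {n : ℕ} (hn : 0 < n) {p : S → ℝ}
    {q : S → (Fin n → X) → ℝ} (hp : p ∈ stdSimplex ℝ S)
    (hq : ∀ s, q s ∈ stdSimplex ℝ (Fin n → X)) : Nonempty X := by
  obtain ⟨s⟩ := nonempty_of_stdSimplex hp
  obtain ⟨x⟩ := nonempty_of_stdSimplex (hq s)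
  exact ⟨x ⟨0, hn⟩⟩

variable {X₁ X₂ Y₁ Y₂ : Type*} [Fintype X₁] [Fintype X₂] [Fintype Y₁] [Fintype Y₂]

/-- For each length `N`, a random superposition code on `N / n` independent super-letters is padded
by `N % n` dummy letters. Scaling by `θ` leaves room for the thresholds and for the padding. -/
lemma achievable_scaled {S₁ S₂ : Type*} [Fintype S₁] [Fintype S₂] {W : Channel X₁ X₂ Y₁ Y₂} {n : ℕ}
    (hn : 0 < n) {R₁s R₁p R₂s R₂p θ : ℝ}
    (hR : (R₁s, R₁p, R₂s, R₂p) ∈ nLetterRegionWith W S₁ S₂ n) (hθ₀ : 0 < θ) (hθ₁ : θ < 1) :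
    Achievable W (θ * R₁s, θ * R₁p, θ * R₂s, θ * R₂p) := by
  obtain ⟨⟨h₁s, h₁p, h₂s, h₂p⟩, p₁, p₂, q₁, q₂, hp₁, hp₂, hq₁, hq₂, hI₁, hI₂, hI₃, hI₄⟩ := hR
  have hV := isChan_block W n
  simp only at hI₁ hI₂ hI₃ hI₄
  rw [condMutualInfo_joint_fst_pair hV hq₁ hq₂] at hI₁
  rw [condMutualInfo_joint_fst hV hp₁ hq₁ hq₂] at hI₂
  rw [condMutualInfo_joint_snd_pair hV hq₁ hq₂] at hI₃
  rw [condMutualInfo_joint_snd hV hp₂ hq₁ hq₂] at hI₄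
  obtain ⟨τ₁, τ₂, ε₁, hτ₁, hτ₂, hlim₁, hε₁⟩ := exists_tendsto_error_bound hp₁ hp₂ hq₁
    (fun s a => effChan_mem hV (hq₂ s) a) hn h₁s h₁p hθ₀ hθ₁ hI₁ hI₂
  obtain ⟨τ₃, τ₄, ε₂, hτ₃, hτ₄, hlim₂, hε₂⟩ := exists_tendsto_error_bound hp₂ hp₁ hq₂
    (fun s a => effChan_mem hV.swap (hq₁ s) a) hn h₂s h₂p hθ₀ hθ₁ hI₃ hI₄
  obtain ⟨x₁⟩ := nonempty_letter hn hp₁ hq₁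
  obtain ⟨x₂⟩ := nonempty_letter hn hp₂ hq₂
  have hcode : ∀ N : ℕ, ∃ c : Code X₁ X₂ Y₁ Y₂ (numMsg N (θ * R₁s)) (numMsg N (θ * R₁p))
      (numMsg N (θ * R₂s)) (numMsg N (θ * R₂p)) N, c.errorProb W ≤ ε₁ N + ε₂ N := by
    intro N
    obtain ⟨e₁, e₂, d₁, d₂, hd⟩ := exists_code_rxErr_le (M₁s := numMsg N (θ * R₁s))
      (M₁p := numMsg N (θ * R₁p)) (M₂s := numMsg N (θ * R₂s)) (M₂p := numMsg N (θ * R₂p))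
      (isChan_powChan hV (N / n)) (powLaw_mem (N / n) hp₁) (powLaw_mem (N / n) hp₂)
      (powKer_mem (N / n) hq₁) (powKer_mem (N / n) hq₂) (hτ₁ N) (hτ₂ N) (hτ₃ N) (hτ₄ N)
    have hσ : Fintype.card ((Fin (N / n) × Fin n) ⊕ Fin (N % n)) = Fintype.card (Fin N) := by
      simp [Nat.div_add_mod']
    have hsim := simulates_powChan W (Fintype.equivOfCardEq hσ) x₁ x₂
    have hU₁ : effChan (powKer (N / n) q₂) (powChan (N / n) (W.block n)) =
        fun s a y => ∏ i, effChan q₂ (W.block n) (s i) (a i) (y i) := by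
      funext s a y
      exact effChan_pow _ _ _ _ _
    have hU₂ : effChan (powKer (N / n) q₁) (swapChan (powChan (N / n) (W.block n))) =
        fun s a y => ∏ i, effChan q₁ (swapChan (W.block n)) (s i) (a i) (y i) := by
      funext s a y
      exact effChan_pow (V := swapChan (W.block n)) _ _ _ _ _
    rw [hU₁, hU₂, hε₁ N, hε₂ N] at hd
    let σ := Fintype.equivOfCardEq hσ
    refine ⟨⟨fun w => padInput σ x₁ (e₁ w), fun w => padInput σ x₂ (e₂ w),
      fun z => d₁ (outputBlocks σ z.1, z.2), fun z => d₂ (outputBlocks σ z.1, z.2)⟩,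
      (errorProb_le_add W _).trans (le_trans (le_of_eq ?_) hd)⟩
    exact congrArg₂ _ (hsim.rxErr_eq e₁ e₂ d₁) (hsim.swap.rxErr_eq e₂ e₁ d₂)
  choose c hc using hcode
  refine ⟨⟨by positivity, by positivity, by positivity, by positivity⟩, c, ?_⟩
  refine squeeze_zero (fun N => ?_) hc (by simpa using hlim₁.add hlim₂)
  unfold Code.errorProb
  refine mul_nonneg (by positivity) ?_
  refine Finset.sum_nonneg fun _ _ => Finset.sum_nonneg fun _ _ => Finset.sum_nonneg fun _ _ =>
    Finset.sum_nonneg fun _ _ => Finset.sum_nonneg fun _ _ => Finset.sum_nonneg fun _ _ => ?_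
  split_ifs
  exacts [(isChan_block W N).nonneg _ _ _ _, le_rfl]

lemma nLetterRegionWith_subset_capacityRegion (S₁ S₂ : Type*) [Fintype S₁] [Fintype S₂]
    (W : Channel X₁ X₂ Y₁ Y₂) {n : ℕ} (hn : 0 < n) :
    nLetterRegionWith W S₁ S₂ n ⊆ capacityRegion W := by
  rintro ⟨R₁s, R₁p, R₂s, R₂p⟩ hR
  have hlim : Tendsto (fun θ : ℝ => (θ * R₁s, θ * R₁p, θ * R₂s, θ * R₂p)) (𝓝[<] 1)
      (𝓝 (R₁s, R₁p, R₂s, R₂p)) := by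
    have hc : Continuous fun θ : ℝ => (θ * R₁s, θ * R₁p, θ * R₂s, θ * R₂p) := by fun_prop
    simpa using (hc.tendsto 1).mono_left nhdsWithin_le_nhds
  refine mem_closure_of_tendsto hlim ?_
  filter_upwards [Ioo_mem_nhdsLT (zero_lt_one' ℝ)] with θ hθ
  exact achievable_scaled hn hR hθ.1 hθ.2

lemma nLetterRegion_subset_capacityRegion (W : Channel X₁ X₂ Y₁ Y₂) {n : ℕ} (hn : 0 < n) :
    nLetterRegion W n ⊆ capacityRegion W :=
  Set.iUnion_subset fun _ => Set.iUnion_subset fun _ =>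
    nLetterRegionWith_subset_capacityRegion _ _ W hn

end Achievability

/-! ### Set limits -/

section SetLimits

/-- An open neighbourhood of a point of `closure T` is also a neighbourhood of a point of `T`, so
the lower limit contains the closure. The upper limit stays inside the closed set that contains all
`A n` with `n > 0`; the index `0` is irrelevant to a limit. -/
lemma isSetLimit_closure {E : Type*} [TopologicalSpace E] {A : ℕ → Set E} {T : Set E}
    (hlow : T ⊆ lowerLimit A) (hup : ∀ n, 0 < n → A n ⊆ closure T) :
    IsSetLimit A (closure T) := by
  have h1 : closure T ⊆ lowerLimit A := by
    intro x hx U hU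
    obtain ⟨V, hVU, hV, hxV⟩ := mem_nhds_iff.1 hU
    obtain ⟨y, hyV, hyT⟩ := mem_closure_iff.1 hx V hV hxV
    filter_upwards [hlow hyT V (hV.mem_nhds hyV)] with n hn
    exact hn.mono (Set.inter_subset_inter_right _ hVU)
  have h2 : lowerLimit A ⊆ upperLimit A := fun x hx U hU => (hx U hU).frequently
  have h3 : upperLimit A ⊆ closure T := by
    intro x hx
    rw [← closure_closure, mem_closure_iff_nhds]
    intro U hU
    obtain ⟨n, ⟨y, hyA, hyU⟩, hn⟩ := ((hx U hU).and_eventually (eventually_gt_atTop 0)).exists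
    exact ⟨y, hyU, hup n hn hyA⟩
  exact ⟨(h2.trans h3).antisymm h1, h3.antisymm (h1.trans h2)⟩

lemma lowerLimit_mono {E : Type*} [TopologicalSpace E] {A B : ℕ → Set E} (h : ∀ n, A n ⊆ B n) :
    lowerLimit A ⊆ lowerLimit B := fun _ hx U hU =>
  (hx U hU).mono fun n hn => hn.mono (Set.inter_subset_inter_left _ (h n))

end SetLimits

end

end InterferenceMSI

theorem lemma1 {X₁ X₂ Y₁ Y₂ : Type*} [Fintype X₁] [Fintype X₂] [Fintype Y₁] [Fintype Y₂]
    (W : InterferenceMSI.Channel X₁ X₂ Y₁ Y₂) :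
    InterferenceMSI.IsSetLimit (fun n => InterferenceMSI.nLetterRegion W n)
      (InterferenceMSI.capacityRegion W) ∧
    (∀ n : ℕ, 1 ≤ n →
      InterferenceMSI.nLetterRegion W n ⊆ InterferenceMSI.capacityRegion W) ∧
    InterferenceMSI.IsSetLimit (fun n => InterferenceMSI.nLetterRegionWith W X₁ X₂ n)
      (InterferenceMSI.capacityRegion W) := by
  refine ⟨InterferenceMSI.isSetLimit_closure (fun R hR => ?_) fun n hn =>
      InterferenceMSI.nLetterRegion_subset_capacityRegion W hn,
    fun n hn => InterferenceMSI.nLetterRegion_subset_capacityRegion W hn,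
    InterferenceMSI.isSetLimit_closure (fun R hR => hR.mem_lowerLimit rfl rfl) fun n hn =>
      InterferenceMSI.nLetterRegionWith_subset_capacityRegion _ _ W hn⟩
  -- Among the auxiliary alphabets in the union are those with as many letters as `X₁` and `X₂`, and
  -- these suffice for the converse.
  exact InterferenceMSI.lowerLimit_mono
    (fun n => Set.subset_iUnion₂ (s := fun m₁ m₂ =>
      InterferenceMSI.nLetterRegionWith W (Fin m₁) (Fin m₂) n)
      (Fintype.card X₁) (Fintype.card X₂))
    (hR.mem_lowerLimit (Fintype.card_fin _) (Fintype.card_fin _))
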